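/- **Setting.** There are $n$ experts with signal spaces $S_1,\dots,S_n$, which are arbitrary measurable spaces (finite or infinite), and a binary event $\omega\in\{0,1\}$. Let $P$ be a joint distribution of the signals $s=(s_1,\dots,s_n)$ and $\omega$. Expert $i$ reports $r_i=P(\omega=1\mid s_i)$, and $r=(r_1,\dots,r_n)$. An aggregator is a (measurable) function $f:[0,1]^n\to[0,1]$, with loss $L_P(f)=\mathbb E_P\big[|f(r)-\omega|^2\big]$. Let $f^*$ be an optimal aggregator, that is, a minimiser of $L_P$ over all aggregators (it is unique up to $P$-almost sure equality). An aggregator $f$ is $\varepsilon$-optimal for $P$ if $\mathbb E_P\big[|f(r)-f^*(r)|^2\big]\le\varepsilon$. For a family $\mathcal P$ of distributions and $\varepsilon,\delta\in(0,1)$, we say that $T$ samples suffice if there is a (possibly randomised) learning procedure that, given $T$ i.i.d. samples $(r^{(t)},\omega^{(t)})$ of reports and event drawn from $P$, outputs for every $P\in\mathcal P$ an $\varepsilon$-optimal aggregator for $P$ with probability at least $1-\delta$ over the samples and the randomness of the procedure. The procedure may depend on $\mathcal P,\varepsilon,\delta,T$ but not on $P$. The sample complexity $T_{\mathcal P}(\varepsilon,\delta)$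 is the least $N\in\mathbb N$ such that every number $T\ge N$ of samples suffices (and $+\infty$ if there is no such $N$). Let $\mathcal P_{\mathrm{ind}}$ be the family of all conditionally independent distributions: those with $P(\omega=1)\in(0,1)$ for which $s_1,\dots,s_n$ are independent conditionally on $\omega=0$ and conditionally on $\omega=1$. **Theorem.** There are absolute constants $C,c>0$ and $\varepsilon_0,\delta_0\in(0,1)$ such that for all $n\ge 2$ and all signal spaces $S_1,\dots,S_n$ the following hold. 1. For all $\varepsilon,\delta\in(0,1)$, $$T_{\mathcal P_{\mathrm{ind}}}(\varepsilon,\delta)\;\le\; \frac{C}{\varepsilon^2}\log\frac1{\varepsilon\delta}.$$ 2. If every $S_i$ is non-trivial, i.e. has a measurable subset that is neither empty nor all of $S_i$ (for a finite $S_i$ with all subsets measurable: $|S_i|\ge 2$), then for all $\varepsilon\in(0,\varepsilon_0]$ and $\delta\in(0,\delta_0]$, $$T_{\mathcal P_{\mathrm{ind}}}(\varepsilon,\delta)\;\ge\; \frac{c}{\varepsilon}\log\frac1\delta.$$ -/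

import Mathlib

open MeasureTheory ProbabilityTheory unitInterval
open scoped ENNReal

namespace ForecastAggregation

noncomputable section

/-- The value in `{0, 1}` of the binary event. -/
def eventValue (ω : Bool) : ℝ := if ω then 1 else 0

/-- A joint distribution of the signals `s = (s_1, …, s_n)` and of the event `ω`. The signal spaces
`S i` are arbitrary measurable spaces, finite or infinite. -/
abbrev Distribution {n : ℕ} (S : Fin n → Type*) [∀ i, MeasurableSpace (S i)] : Type _ :=
  ProbabilityMeasure ((∀ i, S i) × Bool)

/-- A joint report `r = (r_1, …, r_n) ∈ [0, 1]^n`. -/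
abbrev Reports (n : ℕ) : Type := Fin n → I

/-- One data point `(r, ω)`. -/
abbrev Sample (n : ℕ) : Type := Reports n × Bool

section Model

variable {n : ℕ} {S : Fin n → Type*} [∀ i, MeasurableSpace (S i)]

/-- The report `r_i = P(ω = 1 | s_i)` of expert `i` upon the signal `s_i`: the value on `{ω = 1}` of
the regular conditional distribution of `ω` given the `i`-th signal. -/
def report (P : Distribution S) (i : Fin n) (s : S i) : I :=
  ⟨(condDistrib (fun x : (∀ j, S j) × Bool => x.2) (fun x => x.1 i)
      (P : Measure ((∀ j, S j) × Bool)) s).real {true},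
    measureReal_nonneg, measureReal_le_one⟩

/-- The law of `(r, ω)` when `(s, ω) ∼ P` and `r_i = P(ω = 1 | s_i)`. -/
def reportLaw (P : Distribution S) : Measure (Sample n) :=
  (P : Measure ((∀ i, S i) × Bool)).map (fun x => (fun i => report P i (x.1 i), x.2))

/-- The mean squared loss `L_P(f) = E_P |f(r) - ω|²` of an aggregator. -/
def loss (P : Distribution S) (f : Reports n → I) : ℝ :=
  ∫ z, ((f z.1 : ℝ) - eventValue z.2) ^ 2 ∂(reportLaw P)

/-- `f` is an optimal aggregator: it minimises the loss over all (measurable) aggregators. -/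
def IsOptimal (P : Distribution S) (f : Reports n → I) : Prop :=
  Measurable f ∧ ∀ g : Reports n → I, Measurable g → loss P f ≤ loss P g

/-- `f` is `ε`-optimal: `E_P |f(r) - f*(r)|² ≤ ε`, where `f*` is the optimal aggregator (which is
unique up to almost sure equality). -/
def IsEpsOptimal (P : Distribution S) (ε : ℝ) (f : Reports n → I) : Prop :=
  ∃ fstar : Reports n → I, IsOptimal P fstar ∧
    ∫ z, ((f z.1 : ℝ) - (fstar z.1 : ℝ)) ^ 2 ∂(reportLaw P) ≤ ε

end Model

/-- A possibly randomised learning procedure that turns `T` data points into an aggregator; its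
internal randomness is a random seed independent of the data. -/
structure Learner (n T : ℕ) where
  Seed : Type
  measurableSpaceSeed : MeasurableSpace Seed
  seedLaw : ProbabilityMeasure Seed
  output : Seed → (Fin T → Sample n) → Reports n → I
  measurable_output :
    Measurable (fun x : Seed × (Fin T → Sample n) × Reports n => output x.1 x.2.1 x.2.2)

attribute [instance] Learner.measurableSpaceSeed

section Complexity

variable {n : ℕ} {S : Fin n → Type*} [∀ i, MeasurableSpace (S i)]

/-- The joint law of the seed and of `T` independent data points drawn from `P`. -/
def trainingLaw {T : ℕ} (A : Learner n T) (P : Distribution S) :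
    Measure (A.Seed × (Fin T → Sample n)) :=
  (A.seedLaw : Measure A.Seed).prod (Measure.pi (fun _ : Fin T => reportLaw P))

/-- `T` samples suffice: one learning procedure, not knowing which `P` in the family is the true
distribution, outputs an `ε`-optimal aggregator with probability at least `1 - δ` for every `P`. -/
def SamplesSuffice (Q : Set (Distribution S)) (ε δ : ℝ) (T : ℕ) : Prop :=
  ∃ A : Learner n T, ∀ P ∈ Q,
    ENNReal.ofReal (1 - δ) ≤ trainingLaw A P {x | IsEpsOptimal P ε (A.output x.1 x.2)}

/-- The sample complexity of forecast aggregation with respect to `Q`: the least `N` such that every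
`T ≥ N` samples suffice, and `⊤` if there is no such `N`. -/
def sampleComplexity (Q : Set (Distribution S)) (ε δ : ℝ) : ℕ∞ :=
  ⨅ (N : ℕ) (_ : ∀ T : ℕ, N ≤ T → SamplesSuffice Q ε δ T), (N : ℕ∞)

end Complexity

/-- The family of all conditionally independent distributions: the prior `p = P(ω = 1)` lies in
`(0, 1)` and, conditionally on each of the two values of `ω`, the signals are independent. -/
def condIndepFamily {n : ℕ} (S : Fin n → Type*) [∀ i, MeasurableSpace (S i)] :
    Set (Distribution S) :=
  {P | (P : Measure ((∀ i, S i) × Bool)).real {x | x.2 = true} ∈ Set.Ioo (0 : ℝ) 1 ∧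
    ∀ ω : Bool, iIndepFun (fun (i : Fin n) (x : (∀ j, S j) × Bool) => x.1 i)
      (ProbabilityTheory.cond (P : Measure ((∀ i, S i) × Bool)) {x | x.2 = ω})}

end

end ForecastAggregation

namespace ForecastAggregation

/-! Upper bound. Let `p` be the prior and `ρ = p / (1 - p)`. By Bayes' rule and conditional
independence the optimal aggregator is `∏ r_i / (∏ r_i + ρ ^ (n - 1) * ∏ (1 - r_i))`, so only the
number `x = log (ρ ^ (n - 1))` is unknown, whatever `n` and the signal spaces are. This
one-parameter family is monotone in `x`. Hence `f_x - f*` has constant sign and `E |f_x - f*|² ≤ E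
|f_x - f*| = |E f_x - E f*| = |E f_x - E ω|` (`isEpsOptimal_of_abs_meanGap_le`). It is enough to
choose `x` so that the mean forecast matches the frequency of the event up to `ε`. Monotonicity also
replaces uniform convergence: Hoeffding's inequality at the parameters where the mean discrepancy is
`ε` and `-ε`, and at one nearly balanced parameter, controls all `x` at once, so `O(log (1 / δ) /
ε²)` samples are enough when `ε < 1 / 4` (`samplesSuffice_of_exp_le`).

Lower bound. In the hard instance every signal is `b` when `ω = 1` and is `a` with probability `β`
when `ω = 0`, with the prior tuned so that the reports are `0` on `a` and `1 / 2` on `b` for every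
`β`. The values of the reports thus hide `β`, and only their frequencies reveal it. The optimal
forecast at `(1/2, …, 1/2)` is `1 / (1 + (1 - β) ^ (n - 1))`. Passing from `β = 1 / (2n)` to `(1 +
κ)β` moves it by order `κ` (`hardForecast_sub_ge`), while `1 + χ²` for one sample is at most `exp
(2κ²)` (`chiSqBound_hardLaw_exp`). With `κ²` a large multiple of `ε`, no aggregator is good for both
instances. An event of probability at least `1 - δ` under one law then has probability at most `δ`
under the other, which forces `(1 - δ)² ≤ exp (O(ε T)) * δ`. -/

theorem pi_withDensity {ι : Type*} [Fintype ι] {α : ι → Type*} [∀ i, MeasurableSpace (α i)]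
    (μ : ∀ i, Measure (α i)) [∀ i, IsProbabilityMeasure (μ i)] (g : ∀ i, α i → ℝ≥0∞)
    (hg : ∀ i, Measurable (g i)) [∀ i, SigmaFinite ((μ i).withDensity (g i))] :
    Measure.pi (fun i => (μ i).withDensity (g i)) =
      (Measure.pi μ).withDensity (fun x => ∏ i, g i (x i)) := by
  refine Measure.pi_eq fun s hs => ?_
  rw [withDensity_apply _ (MeasurableSet.univ_pi hs),
    ← lintegral_indicator (MeasurableSet.univ_pi hs)]
  have hm : ∀ i, Measurable ((s i).indicator (g i)) := fun i => (hg i).indicator (hs i)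
  have h1 : (Set.univ.pi s).indicator (fun x => ∏ i, g i (x i)) =
      fun x => ∏ i, (s i).indicator (g i) (x i) := by
    funext x
    by_cases hx : x ∈ Set.univ.pi s
    · rw [Set.indicator_of_mem hx]
      exact Finset.prod_congr rfl fun i _ => (Set.indicator_of_mem (hx i trivial) _).symm
    · rw [Set.indicator_of_notMem hx]
      obtain ⟨i, hi⟩ : ∃ i, x i ∉ s i := by simpa [Set.mem_pi] using hx
      exact (Finset.prod_eq_zero (Finset.mem_univ i) (Set.indicator_of_notMem hi _)).symm
  rw [h1, lintegral_prod_eq_prod_lintegral_of_indepFun Finset.univ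
    (fun i (x : ∀ i, α i) => (s i).indicator (g i) (x i))
    (iIndepFun_pi fun i => (hm i).aemeasurable) (fun i => (hm i).comp (measurable_pi_apply i))]
  refine Finset.prod_congr rfl fun i _ => ?_
  rw [withDensity_apply _ (hs i), ← lintegral_indicator (hs i)]
  exact (measurePreserving_eval μ i).lintegral_comp (hm i)

/-! ### Law of the reports under conditional independence -/

section Structure

variable {n : ℕ} {S : Fin n → Type*} [∀ i, MeasurableSpace (S i)]

theorem measurable_report (P : Distribution S) (i : Fin n) : Measurable (report P i) :=
  Measurable.subtype_mk
    (Kernel.measurable_coe _ (measurableSet_singleton true)).ennreal_toReal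

theorem measurable_reports (P : Distribution S) :
    Measurable (fun x : (∀ i, S i) × Bool => fun i => report P i (x.1 i)) :=
  measurable_pi_iff.2 fun i =>
    (measurable_report P i).comp ((measurable_pi_apply i).comp measurable_fst)

instance (P : Distribution S) : IsProbabilityMeasure (reportLaw P) :=
  Measure.isProbabilityMeasure_map ((measurable_reports P).prodMk measurable_snd).aemeasurable

/-- The conditional probability that the event takes the value `v`, given a report `r`. -/
noncomputable def weight (v : Bool) (r : I) : ℝ≥0∞ :=
  ENNReal.ofReal (if v then (r : ℝ) else 1 - r)

theorem measurable_weight (v : Bool) : Measurable (weight v) := by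
  unfold weight
  cases v
  · exact ENNReal.measurable_ofReal.comp (measurable_const.sub measurable_subtype_coe)
  · exact ENNReal.measurable_ofReal.comp measurable_subtype_coe

theorem condDistrib_eq_weight (P : Distribution S) (i : Fin n) (s : S i) (v : Bool) :
    condDistrib (fun x : (∀ j, S j) × Bool => x.2) (fun x => x.1 i)
      (P : Measure ((∀ j, S j) × Bool)) s {v} = weight v (report P i s) := by
  cases v
  · have : ({false} : Set Bool) = {true}ᶜ := by ext b; cases b <;> simp
    rw [← ofReal_measureReal, this, probReal_compl_eq_one_sub (measurableSet_singleton true)]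
    rfl
  · rw [← ofReal_measureReal]; rfl

/-- Calibration of the reports. The upper bound uses it for Bayes' rule, the lower bound to compute
the reports of the hard instance. -/
theorem setLIntegral_weight_report (P : Distribution S) (i : Fin n) (v : Bool) {D : Set (S i)}
    (hD : MeasurableSet D) :
    ∫⁻ x in (fun x : (∀ j, S j) × Bool => x.1 i) ⁻¹' D, weight v (report P i (x.1 i)) ∂P =
      (P : Measure ((∀ j, S j) × Bool)) ((fun x => x.1 i) ⁻¹' D ∩ {x | x.2 = v}) := by
  have := setLIntegral_preimage_condDistrib (μ := (P : Measure ((∀ j, S j) × Bool)))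
    (X := fun x : (∀ j, S j) × Bool => x.1 i) (Y := fun x => x.2) (s := {v})
    ((measurable_pi_apply i).comp measurable_fst) measurable_snd.aemeasurable
    (measurableSet_singleton v) hD
  simp_rw [condDistrib_eq_weight] at this
  exact this

/-- The law of the report of expert `i`. -/
noncomputable def reportMarginal (P : Distribution S) (i : Fin n) : Measure I :=
  (P : Measure ((∀ i, S i) × Bool)).map (fun x => report P i (x.1 i))

theorem measurable_report_comp (P : Distribution S) (i : Fin n) :
    Measurable (fun x : (∀ i, S i) × Bool => report P i (x.1 i)) :=
  (measurable_report P i).comp ((measurable_pi_apply i).comp measurable_fst)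

instance (P : Distribution S) (i : Fin n) : IsProbabilityMeasure (reportMarginal P i) :=
  Measure.isProbabilityMeasure_map (measurable_report_comp P i).aemeasurable

/-- The prior probability of the value `v` of the event. -/
noncomputable def prior (P : Distribution S) (v : Bool) : ℝ≥0∞ :=
  (P : Measure ((∀ i, S i) × Bool)) {x | x.2 = v}

theorem measurableSet_event {α : Type*} [MeasurableSpace α] (v : Bool) :
    MeasurableSet {x : α × Bool | x.2 = v} :=
  measurable_snd (measurableSet_singleton v)

theorem prior_false (P : Distribution S) : prior P false = 1 - prior P true := by
  have : {x : (∀ i, S i) × Bool | x.2 = false} = {x | x.2 = true}ᶜ := by ext; simp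
  rw [prior, prior, this, prob_compl_eq_one_sub (measurableSet_event true)]

/-- Bayes' rule for one report: conditioning on the event reweights the marginal by posterior over
prior. -/
theorem cond_map_report (P : Distribution S) (i : Fin n) (v : Bool) :
    (cond (P : Measure ((∀ i, S i) × Bool)) {x | x.2 = v}).map (fun x => report P i (x.1 i)) =
      (reportMarginal P i).withDensity (fun r => (prior P v)⁻¹ * weight v r) := by
  ext D hD
  rw [Measure.map_apply (measurable_report_comp P i) hD, cond_apply (measurableSet_event v),
    withDensity_apply _ hD, reportMarginal,
    setLIntegral_map hD ((measurable_weight v).const_mul _) (measurable_report_comp P i),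
    lintegral_const_mul _ (by exact (measurable_weight v).comp (measurable_report_comp P i)),
    Set.inter_comm]
  congr 1
  exact (setLIntegral_weight_report P i v (measurable_report P i hD)).symm

/-- Conditional independence multiplies the one-report densities of `cond_map_report`. The reference
measure is the same for both values of `v`, so the two densities can be compared pointwise, although
it need not be the law of the joint report. -/
theorem restrict_event_map_fst {P : Distribution S} (hP : P ∈ condIndepFamily S) (v : Bool) :
    ((reportLaw P).restrict {z | z.2 = v}).map Prod.fst =
      (Measure.pi (reportMarginal P)).withDensity
        (fun r => prior P v * ∏ i, (prior P v)⁻¹ * weight v (r i)) := by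
  have hprob := (hP.2 v).isProbabilityMeasure
  -- Conditioning on a null event gives the zero measure, whereas the independence hypothesis makes
  -- the conditional measure a probability measure.
  have hne : prior P v ≠ 0 := fun h => by
    have := hprob.measure_univ
    rw [cond_eq_zero_of_meas_eq_zero h] at this
    simp at this
  have hR := measurable_reports P
  have hw : ∀ i : Fin n, Measurable fun r => (prior P v)⁻¹ * weight v r :=
    fun i => (measurable_weight v).const_mul _
  rw [reportLaw, Measure.restrict_map (hR.prodMk measurable_snd) (measurableSet_event v),
    Measure.map_map measurable_fst (hR.prodMk measurable_snd)]
  have h1 : (P : Measure ((∀ i, S i) × Bool)).restrict {x | x.2 = v} =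
      prior P v • cond (P : Measure ((∀ i, S i) × Bool)) {x | x.2 = v} := by
    rw [ProbabilityTheory.cond, smul_smul]
    change _ = (prior P v * (prior P v)⁻¹) • _
    rw [ENNReal.mul_inv_cancel hne (measure_ne_top _ _), one_smul]
  change ((P : Measure ((∀ i, S i) × Bool)).restrict {x | x.2 = v}).map
    (fun x => fun i => report P i (x.1 i)) = _
  have h2 : iIndepFun (fun (i : Fin n) (x : (∀ j, S j) × Bool) => report P i (x.1 i))
      (ProbabilityTheory.cond (P : Measure ((∀ i, S i) × Bool)) {x | x.2 = v}) :=
    (hP.2 v).comp (fun i => report P i) (fun i => measurable_report P i)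
  rw [h1, Measure.map_smul, h2.map_fun_eq_pi_map fun i => (measurable_report_comp P i).aemeasurable]
  simp_rw [cond_map_report]
  have : ∀ i, IsProbabilityMeasure
      ((reportMarginal P i).withDensity fun r => (prior P v)⁻¹ * weight v r) := fun i => by
    rw [← cond_map_report]
    exact Measure.isProbabilityMeasure_map (measurable_report_comp P i).aemeasurable
  rw [pi_withDensity _ _ hw, ← withDensity_smul]
  · rfl
  · exact Finset.measurable_prod _ fun i _ => (hw i).comp (measurable_pi_apply i)

end Structure

/-! ### The one-parameter family of candidate aggregators -/

section Aggregator

variable {n : ℕ}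

theorem prod_reports_nonneg (r : Reports n) : 0 ≤ ∏ i, (r i : ℝ) :=
  Finset.prod_nonneg fun i _ => (r i).2.1

theorem prod_one_sub_reports_nonneg (r : Reports n) : 0 ≤ ∏ i, (1 - (r i : ℝ)) :=
  Finset.prod_nonneg fun i _ => sub_nonneg.2 (r i).2.2

theorem div_add_mul_mem_unitInterval {a b t : ℝ} (ha : 0 ≤ a) (hb : 0 ≤ b) (ht : 0 ≤ t) :
    a / (a + t * b) ∈ I :=
  ⟨by positivity, div_le_one_of_le₀ (le_add_of_nonneg_right (by positivity)) (by positivity)⟩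

/-- The aggregator that is optimal for conditionally independent signals when the prior odds of the
event are `ρ` and `exp x = ρ ^ (n - 1)`. -/
noncomputable def aggregator (x : ℝ) (r : Reports n) : I :=
  ⟨(∏ i, (r i : ℝ)) / (∏ i, (r i : ℝ) + Real.exp x * ∏ i, (1 - (r i : ℝ))),
    div_add_mul_mem_unitInterval (prod_reports_nonneg r) (prod_one_sub_reports_nonneg r)
      (Real.exp_pos x).le⟩

theorem measurable_aggregator (x : ℝ) : Measurable (aggregator (n := n) x) := by
  have h1 : Measurable fun r : Reports n => ∏ i, (r i : ℝ) := by fun_prop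
  have h2 : Measurable fun r : Reports n => ∏ i, (1 - (r i : ℝ)) := by fun_prop
  exact (h1.div (h1.add (h2.const_mul _))).subtype_mk

theorem aggregator_antitone (r : Reports n) {x y : ℝ} (h : x ≤ y) :
    (aggregator y r : ℝ) ≤ aggregator x r := by
  have hA := prod_reports_nonneg r
  have hB := prod_one_sub_reports_nonneg r
  -- If the numerator vanishes, the value is `0` for every parameter, also in the case `0 / 0`.
  -- Otherwise the denominator is positive.
  rcases hA.eq_or_lt with h0 | h0
  · simp [aggregator, ← h0]
  · simp only [aggregator]
    gcongr

theorem continuous_aggregator (r : Reports n) : Continuous fun x => (aggregator x r : ℝ) := by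
  have hA := prod_reports_nonneg r
  have hB := prod_one_sub_reports_nonneg r
  rcases hA.eq_or_lt with h0 | h0
  · simp only [aggregator, ← h0, zero_div]
    fun_prop
  · simp only [aggregator]
    refine Continuous.div (by fun_prop) (by fun_prop) fun x => ?_
    positivity

end Aggregator

/-! ### The optimal aggregator and the excess loss -/

section Optimal

variable {n : ℕ} {S : Fin n → Type*} [∀ i, MeasurableSpace (S i)]

/-- The parameter of the aggregator that is optimal for `P`. -/
noncomputable def optParam (P : Distribution S) : ℝ :=
  Real.log (((prior P true).toReal / (1 - (prior P true).toReal)) ^ (n - 1))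

theorem prod_prior_inv_mul_weight {w : ℝ} (hw : 0 < w) (v : Bool) (r : Reports n) :
    ENNReal.ofReal w * ∏ i, (ENNReal.ofReal w)⁻¹ * weight v (r i) =
      ENNReal.ofReal (w * (w⁻¹ ^ n * ∏ i, if v then (r i : ℝ) else 1 - r i)) := by
  have h0 : ∀ i, 0 ≤ if v then (r i : ℝ) else 1 - r i := fun i => by
    cases v
    · simpa using (r i).2.2
    · simpa using (r i).2.1
  rw [ENNReal.ofReal_mul hw.le, ENNReal.ofReal_mul (by positivity),
    ENNReal.ofReal_prod_of_nonneg fun i _ => h0 i, Finset.prod_mul_distrib, Finset.prod_const,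
    Finset.card_univ, Fintype.card_fin, ENNReal.ofReal_pow (by positivity),
    ENNReal.ofReal_inv_of_pos hw]
  rfl

theorem posterior_identity {m : ℕ} {p a b : ℝ} (hp : 0 < p) (hp1 : p < 1) (ha : 0 ≤ a)
    (hb : 0 ≤ b) :
    (a / (a + (p / (1 - p)) ^ m * b)) *
      (p * (p⁻¹ ^ (m + 1) * a) + (1 - p) * ((1 - p)⁻¹ ^ (m + 1) * b)) =
      p * (p⁻¹ ^ (m + 1) * a) := by
  have hq : 0 < 1 - p := by linarith
  rcases ha.eq_or_lt with h0 | h0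
  · simp [← h0]
  · have : a + (p / (1 - p)) ^ m * b ≠ 0 := by positivity
    rw [div_pow] at this ⊢
    have h1 : p * (p⁻¹ ^ (m + 1) * a) + (1 - p) * ((1 - p)⁻¹ ^ (m + 1) * b) =
      p⁻¹ ^ m * (a + p ^ m / (1 - p) ^ m * b) := by
      rw [pow_succ, pow_succ, inv_pow, inv_pow]
      field_simp
    rw [h1, div_mul_eq_mul_div, div_eq_iff this, pow_succ]
    field_simp

theorem prior_true_mem {P : Distribution S} (hP : P ∈ condIndepFamily S) :
    (prior P true).toReal ∈ Set.Ioo (0 : ℝ) 1 := hP.1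

theorem exp_optParam {P : Distribution S} (hP : P ∈ condIndepFamily S) :
    Real.exp (optParam P) =
      ((prior P true).toReal / (1 - (prior P true).toReal)) ^ (n - 1) := by
  obtain ⟨h0, h1⟩ := prior_true_mem hP
  exact Real.exp_log (pow_pos (div_pos h0 (by linarith)) _)

/-- The aggregator with parameter `optParam P` is a version of `P(ω = 1 | r)`: by
`restrict_event_map_fst` it is the density of the part with `ω = 1` divided by the sum of both
parts, which is the algebra of `posterior_identity`. -/
theorem restrict_true_map_fst (hn : 1 ≤ n) {P : Distribution S} (hP : P ∈ condIndepFamily S) :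
    ((reportLaw P).restrict {z | z.2 = true}).map Prod.fst =
      ((reportLaw P).map Prod.fst).withDensity
        (fun r => ENNReal.ofReal (aggregator (optParam P) r)) := by
  obtain ⟨h0, h1⟩ := prior_true_mem hP
  have hwt : prior P true = ENNReal.ofReal (prior P true).toReal :=
    (ENNReal.ofReal_toReal (measure_ne_top _ _)).symm
  have hwf : prior P false = ENNReal.ofReal (1 - (prior P true).toReal) := by
    rw [prior_false, ENNReal.ofReal_sub _ h0.le, ← hwt, ENNReal.ofReal_one]
  have hmeas : ∀ v, Measurable fun r : Reports n =>
      prior P v * ∏ i, (prior P v)⁻¹ * weight v (r i) := fun v =>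
    (Finset.measurable_prod _ fun i _ =>
      ((measurable_weight v).comp (measurable_pi_apply i)).const_mul _).const_mul _
  have hf : Measurable fun r : Reports n => ENNReal.ofReal (aggregator (optParam P) r) :=
    ENNReal.measurable_ofReal.comp (measurable_subtype_coe.comp (measurable_aggregator _))
  have hsplit : (reportLaw P).map Prod.fst =
      ((reportLaw P).restrict {z | z.2 = true}).map Prod.fst +
      ((reportLaw P).restrict {z | z.2 = false}).map Prod.fst := by
    have : {z : Sample n | z.2 = false} = {z | z.2 = true}ᶜ := by ext; simp
    rw [← Measure.map_add _ _ measurable_fst, this,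
      Measure.restrict_add_restrict_compl (measurableSet_event true)]
  rw [hsplit, restrict_event_map_fst hP, restrict_event_map_fst hP,
    ← withDensity_add_left (hmeas true),
    ← withDensity_mul _ ((hmeas true).add (hmeas false)) hf]
  congr 1
  funext r
  simp only [Pi.mul_apply, Pi.add_apply]
  rw [hwf, hwt, ENNReal.toReal_ofReal h0.le, prod_prior_inv_mul_weight h0,
    prod_prior_inv_mul_weight (by linarith : 0 < 1 - (prior P true).toReal)]
  have hA := prod_reports_nonneg r
  have hB := prod_one_sub_reports_nonneg r
  have hq : 0 < 1 - (prior P true).toReal := by linarith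
  simp only [if_true, Bool.false_eq_true, if_false]
  rw [← ENNReal.ofReal_add (by positivity) (by positivity), ← ENNReal.ofReal_mul (by positivity)]
  congr 1
  obtain ⟨m, rfl⟩ : ∃ m, n = m + 1 := ⟨n - 1, by omega⟩
  refine (posterior_identity h0 h1 hA hB).symm.trans ((mul_comm _ _).trans ?_)
  simp only [aggregator]
  rw [exp_optParam hP]
  rfl

theorem integral_mul_eventValue (hn : 1 ≤ n) {P : Distribution S} (hP : P ∈ condIndepFamily S)
    {h : Reports n → ℝ} (hh : Measurable h) :
    ∫ z, h z.1 * eventValue z.2 ∂(reportLaw P) =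
      ∫ z, h z.1 * aggregator (optParam P) z.1 ∂(reportLaw P) := by
  have e1 : ∫ z, h z.1 * eventValue z.2 ∂(reportLaw P) =
      ∫ z in {z | z.2 = true}, h z.1 ∂(reportLaw P) := by
    rw [← integral_indicator (measurableSet_event true)]
    refine integral_congr_ae (.of_forall fun z => ?_)
    rcases z with ⟨r, _ | _⟩ <;> simp [eventValue]
  have hm := measurable_aggregator (n := n) (optParam P)
  rw [e1, ← integral_map (f := h) measurable_fst.aemeasurable hh.aestronglyMeasurable,
    restrict_true_map_fst hn hP, integral_withDensity_eq_integral_toReal_smul (by fun_prop)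
      (.of_forall fun _ => ENNReal.ofReal_lt_top),
    integral_map measurable_fst.aemeasurable (by fun_prop)]
  refine integral_congr_ae (.of_forall fun z => ?_)
  simp [ENNReal.toReal_ofReal (aggregator (optParam P) z.1).2.1, mul_comm]

theorem abs_sub_le_one_of_mem {a b : ℝ} (ha : a ∈ I) (hb : b ∈ I) : |a - b| ≤ 1 :=
  abs_le.2 ⟨by linarith [ha.1, hb.2], by linarith [ha.2, hb.1]⟩

theorem eventValue_mem (b : Bool) : eventValue b ∈ I := by
  cases b <;> simp [eventValue]

theorem measurable_eventValue : Measurable eventValue := measurable_of_countable _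

theorem integrable_of_abs_le_one {α : Type*} [MeasurableSpace α] {μ : Measure α}
    [IsFiniteMeasure μ] {f : α → ℝ} (hf : Measurable f) (h : ∀ x, |f x| ≤ 1) : Integrable f μ :=
  .of_bound hf.aestronglyMeasurable 1 (.of_forall h)

theorem integrable_sq_sub {μ : Measure (Sample n)} [IsFiniteMeasure μ] {f g : Reports n → I}
    (hf : Measurable f) (hg : Measurable g) :
    Integrable (fun z : Sample n => ((f z.1 : ℝ) - g z.1) ^ 2) μ :=
  integrable_of_abs_le_one (by fun_prop) fun z => by
    rw [abs_pow]
    exact pow_le_one₀ (abs_nonneg _) (abs_sub_le_one_of_mem (f z.1).2 (g z.1).2)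

/-- Pythagoras: the residual of the conditional expectation is orthogonal to every function of the
reports. -/
theorem loss_eq (hn : 1 ≤ n) {P : Distribution S} (hP : P ∈ condIndepFamily S)
    {g : Reports n → I} (hg : Measurable g) :
    loss P g = loss P (aggregator (optParam P)) +
      ∫ z, ((g z.1 : ℝ) - aggregator (optParam P) z.1) ^ 2 ∂(reportLaw P) := by
  set f := aggregator (n := n) (optParam P) with hf_def
  have hf : Measurable f := measurable_aggregator _
  have hz := integral_mul_eventValue hn hP (h := fun r => (g r : ℝ) - f r) (by fun_prop)
  have hev := measurable_eventValue
  have b1 : ∀ z : Sample n, |(g z.1 : ℝ) - f z.1| ≤ 1 :=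
    fun z => abs_sub_le_one_of_mem (g z.1).2 (f z.1).2
  have b2 : ∀ z : Sample n, |(f z.1 : ℝ) - eventValue z.2| ≤ 1 :=
    fun z => abs_sub_le_one_of_mem (f z.1).2 (eventValue_mem z.2)
  have i1 : Integrable (fun z : Sample n => ((f z.1 : ℝ) - eventValue z.2) ^ 2) (reportLaw P) :=
    integrable_of_abs_le_one (by fun_prop) fun z => by
      rw [abs_pow]; exact pow_le_one₀ (abs_nonneg _) (b2 z)
  have i2 := integrable_sq_sub (μ := reportLaw P) hg hf
  have i3 : Integrable (fun z : Sample n => ((g z.1 : ℝ) - f z.1) * f z.1) (reportLaw P) :=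
    integrable_of_abs_le_one (by fun_prop) fun z => by
      rw [abs_mul]
      exact mul_le_one₀ (b1 z) (abs_nonneg _) (abs_le.2 ⟨by linarith [(f z.1).2.1], (f z.1).2.2⟩)
  have i4 : Integrable (fun z : Sample n => ((g z.1 : ℝ) - f z.1) * eventValue z.2)
      (reportLaw P) :=
    integrable_of_abs_le_one (by fun_prop) fun z => by
      rw [abs_mul]
      exact mul_le_one₀ (b1 z) (abs_nonneg _)
        (abs_le.2 ⟨by linarith [(eventValue_mem z.2).1], (eventValue_mem z.2).2⟩)
  have key : loss P g = ∫ z, (((f z.1 : ℝ) - eventValue z.2) ^ 2 + ((g z.1 : ℝ) - f z.1) ^ 2 +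
      2 * (((g z.1 : ℝ) - f z.1) * f z.1 - ((g z.1 : ℝ) - f z.1) * eventValue z.2))
      ∂(reportLaw P) :=
    integral_congr_ae (.of_forall fun z => by ring)
  have i12 : Integrable (fun z : Sample n => ((f z.1 : ℝ) - eventValue z.2) ^ 2 +
      ((g z.1 : ℝ) - f z.1) ^ 2) (reportLaw P) := i1.add i2
  have i34 : Integrable (fun z : Sample n => 2 * (((g z.1 : ℝ) - f z.1) * f z.1 -
      ((g z.1 : ℝ) - f z.1) * eventValue z.2)) (reportLaw P) := (i3.sub i4).const_mul 2
  rw [key, integral_add i12 i34, integral_add i1 i2, integral_const_mul, integral_sub i3 i4, hz, sub_self, mul_zero, add_zero]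
  rfl

theorem isOptimal_aggregator (hn : 1 ≤ n) {P : Distribution S} (hP : P ∈ condIndepFamily S) :
    IsOptimal P (aggregator (optParam P)) := by
  refine ⟨measurable_aggregator _, fun g hg => ?_⟩
  rw [loss_eq hn hP hg]
  exact le_add_of_nonneg_right (integral_nonneg fun z => sq_nonneg _)

theorem IsOptimal.ae_eq (hn : 1 ≤ n) {P : Distribution S} (hP : P ∈ condIndepFamily S)
    {g : Reports n → I} (hg : IsOptimal P g) :
    ∀ᵐ z ∂(reportLaw P), g z.1 = aggregator (optParam P) z.1 := by
  have h1 := hg.2 _ (measurable_aggregator (optParam P))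
  rw [loss_eq hn hP hg.1] at h1
  have hm := measurable_aggregator (n := n) (optParam P)
  have h2 : ∫ z, ((g z.1 : ℝ) - aggregator (optParam P) z.1) ^ 2 ∂(reportLaw P) = 0 :=
    le_antisymm (by linarith) (integral_nonneg fun z => sq_nonneg _)
  rw [integral_eq_zero_iff_of_nonneg (fun z => sq_nonneg _)
    (integrable_sq_sub hg.1 hm)] at h2
  filter_upwards [h2] with z hz
  exact Subtype.ext (sub_eq_zero.1 (pow_eq_zero_iff two_ne_zero |>.1 hz))

theorem isEpsOptimal_iff (hn : 1 ≤ n) {P : Distribution S} (hP : P ∈ condIndepFamily S) {ε : ℝ}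
    {f : Reports n → I} :
    IsEpsOptimal P ε f ↔
      ∫ z, ((f z.1 : ℝ) - aggregator (optParam P) z.1) ^ 2 ∂(reportLaw P) ≤ ε := by
  refine ⟨fun ⟨g, hg, h⟩ => ?_, fun h => ⟨_, isOptimal_aggregator hn hP, h⟩⟩
  refine le_of_eq_of_le (integral_congr_ae ?_) h
  filter_upwards [hg.ae_eq hn hP] with z hz
  rw [hz]

end Optimal

/-! ### Hoeffding's inequality for bounded samples -/

section Hoeffding

variable {α : Type*} [MeasurableSpace α] {μ : Measure α} [IsProbabilityMeasure μ] {X : α → ℝ}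

theorem hoeffding_upper (hX : Measurable X) (hb : ∀ a, |X a| ≤ 1) {T : ℕ} (hT : 0 < T) {s : ℝ}
    (hs : 0 ≤ s) :
    (Measure.pi fun _ : Fin T => μ).real {y | T * (∫ a, X a ∂μ + s) ≤ ∑ j, X (y j)} ≤
      Real.exp (-(T * s ^ 2 / 2)) := by
  have hsub : HasSubgaussianMGF (fun a => X a - ∫ a, X a ∂μ) ((‖(1 : ℝ) - (-1)‖₊ / 2) ^ 2) μ :=
    hasSubgaussianMGF_of_mem_Icc hX.aemeasurable (.of_forall fun a => abs_le.1 (hb a))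
  have hind := iIndepFun_pi (μ := fun _ : Fin T => μ) (X := fun _ a => X a - ∫ a, X a ∂μ)
    (fun _ => (hX.sub_const _).aemeasurable)
  have hsub' : ∀ j ∈ (Finset.univ : Finset (Fin T)),
      HasSubgaussianMGF (fun y : Fin T → α => X (y j) - ∫ a, X a ∂μ)
        ((‖(1 : ℝ) - (-1)‖₊ / 2) ^ 2) (Measure.pi fun _ : Fin T => μ) := fun j _ => by
    refine HasSubgaussianMGF.of_map (X := fun a => X a - ∫ a, X a ∂μ)
      (Y := fun y : Fin T → α => y j) (measurable_pi_apply j).aemeasurable ?_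
    rw [(measurePreserving_eval (fun _ : Fin T => μ) j).map_eq]
    exact hsub
  have h := HasSubgaussianMGF.measure_sum_ge_le_of_iIndepFun hind hsub'
    (ε := T * s) (by positivity)
  have hT' : (0 : ℝ) < T := by exact_mod_cast hT
  -- A variable in `[-1, 1]` has variance proxy `1`, so the sum has proxy `T`.
  have hc : ((∑ _j : Fin T, (‖(1 : ℝ) - (-1)‖₊ / 2) ^ 2 : NNReal) : ℝ) = T := by
    simp only [Finset.sum_const, Finset.card_univ, Fintype.card_fin, nsmul_eq_mul]
    push_cast
    norm_num
  rw [hc] at h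
  have hset : {y : Fin T → α | T * (∫ a, X a ∂μ + s) ≤ ∑ j, X (y j)} =
      {y | T * s ≤ ∑ j, (X (y j) - ∫ a, X a ∂μ)} := by
    ext y
    simp only [Set.mem_ofPred_eq, Finset.sum_sub_distrib, Finset.sum_const, Finset.card_univ,
      Fintype.card_fin, nsmul_eq_mul]
    constructor <;> intro h <;> linarith
  rw [hset]
  refine h.trans_eq ?_
  congr 1
  field_simp

theorem hoeffding_lower (hX : Measurable X) (hb : ∀ a, |X a| ≤ 1) {T : ℕ} (hT : 0 < T) {s : ℝ}
    (hs : 0 ≤ s) :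
    (Measure.pi fun _ : Fin T => μ).real {y | ∑ j, X (y j) ≤ T * (∫ a, X a ∂μ - s)} ≤
      Real.exp (-(T * s ^ 2 / 2)) := by
  have h := hoeffding_upper (μ := μ) (X := fun a => -X a) hX.neg (fun a => by simpa using hb a)
    hT hs
  refine le_trans (measureReal_mono fun y hy => ?_) h
  simp only [Set.mem_ofPred_eq, integral_neg, Finset.sum_neg_distrib] at hy ⊢
  linarith

end Hoeffding

/-! ### Mean discrepancy, and tests that control all parameters -/

section Discrepancy

variable {n : ℕ}

/-- The difference between the forecast of `aggregator x` and the value of the event. -/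
noncomputable def gap (x : ℝ) (z : Sample n) : ℝ := aggregator x z.1 - eventValue z.2

theorem measurable_gap (x : ℝ) : Measurable (gap (n := n) x) :=
  (measurable_subtype_coe.comp ((measurable_aggregator x).comp measurable_fst)).sub
    (measurable_eventValue.comp measurable_snd)

theorem abs_gap_le_one (x : ℝ) (z : Sample n) : |gap x z| ≤ 1 :=
  abs_sub_le_one_of_mem (aggregator x z.1).2 (eventValue_mem z.2)

theorem integrable_gap (x : ℝ) (μ : Measure (Sample n)) [IsFiniteMeasure μ] :
    Integrable (gap x) μ :=
  integrable_of_abs_le_one (measurable_gap x) (abs_gap_le_one x)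

theorem gap_antitone (z : Sample n) {x y : ℝ} (h : x ≤ y) : gap y z ≤ gap x z :=
  sub_le_sub_right (aggregator_antitone z.1 h) _

/-- The mean of `gap x`. -/
noncomputable def meanGap (μ : Measure (Sample n)) (x : ℝ) : ℝ := ∫ z, gap x z ∂μ

theorem antitone_meanGap (μ : Measure (Sample n)) [IsFiniteMeasure μ] : Antitone (meanGap μ) :=
  fun x y h => integral_mono (integrable_gap y μ) (integrable_gap x μ) fun z => gap_antitone z h

theorem continuous_meanGap (μ : Measure (Sample n)) [IsFiniteMeasure μ] :
    Continuous (meanGap μ) :=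
  continuous_of_dominated (bound := fun _ => 1) (fun x => (measurable_gap x).aestronglyMeasurable)
    (fun x => .of_forall (abs_gap_le_one x)) (integrable_const _)
    (.of_forall fun z => (continuous_aggregator z.1).sub continuous_const)

/-- The sum of `gap x` over the data points. -/
noncomputable def sumGap {T : ℕ} (x : ℝ) (y : Fin T → Sample n) : ℝ := ∑ j, gap x (y j)

theorem measurable_sumGap {T : ℕ} (x : ℝ) : Measurable (sumGap (n := n) (T := T) x) :=
  Finset.measurable_sum _ fun j _ => (measurable_gap x).comp (measurable_pi_apply j)

theorem sumGap_antitone {T : ℕ} (y : Fin T → Sample n) {x x' : ℝ} (h : x ≤ x') :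
    sumGap x' y ≤ sumGap x y :=
  Finset.sum_le_sum fun j _ => gap_antitone (y j) h

variable {S : Fin n → Type*} [∀ i, MeasurableSpace (S i)]

theorem integral_gap_sub (hn : 1 ≤ n) {P : Distribution S} (hP : P ∈ condIndepFamily S) (x : ℝ) :
    ∫ z, ((aggregator x z.1 : ℝ) - aggregator (optParam P) z.1) ∂(reportLaw P) =
      meanGap (reportLaw P) x := by
  have hm := measurable_aggregator (n := n)
  have hi : ∀ x, Integrable (fun z : Sample n => (aggregator x z.1 : ℝ)) (reportLaw P) :=
    fun x => integrable_of_abs_le_one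
      (measurable_subtype_coe.comp ((hm x).comp measurable_fst)) fun z =>
        abs_le.2 ⟨by linarith [(aggregator x z.1).2.1], (aggregator x z.1).2.2⟩
  have he : Integrable (fun z : Sample n => eventValue z.2) (reportLaw P) :=
    integrable_of_abs_le_one (measurable_eventValue.comp measurable_snd) fun z =>
      abs_le.2 ⟨by linarith [(eventValue_mem z.2).1], (eventValue_mem z.2).2⟩
  have h := integral_mul_eventValue hn hP (h := fun _ => (1 : ℝ)) measurable_const
  simp only [one_mul] at h
  rw [integral_sub (hi x) (hi _), ← h, ← integral_sub (hi x) he]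
  rfl

theorem meanGap_optParam (hn : 1 ≤ n) {P : Distribution S} (hP : P ∈ condIndepFamily S) :
    meanGap (reportLaw P) (optParam P) = 0 := by
  simp [← integral_gap_sub hn hP]

/-- Two aggregators of the family are ordered pointwise, so the `L¹` distance between them is the
absolute difference of their means; it dominates the squared distance because values lie in `[0,
1]`. -/
theorem isEpsOptimal_of_abs_meanGap_le (hn : 1 ≤ n) {P : Distribution S}
    (hP : P ∈ condIndepFamily S) {x ε : ℝ} (h : |meanGap (reportLaw P) x| ≤ ε) :
    IsEpsOptimal P ε (aggregator x) := by
  have hm := measurable_aggregator (n := n)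
  have hi : Integrable (fun z : Sample n =>
      (aggregator x z.1 : ℝ) - aggregator (optParam P) z.1) (reportLaw P) :=
    integrable_of_abs_le_one
      ((measurable_subtype_coe.comp ((hm x).comp measurable_fst)).sub
        (measurable_subtype_coe.comp ((hm _).comp measurable_fst))) fun z =>
        abs_sub_le_one_of_mem (aggregator x z.1).2 (aggregator _ z.1).2
  rw [← integral_gap_sub hn hP] at h
  rw [isEpsOptimal_iff hn hP]
  refine le_trans ?_ h
  have hsq : ∀ z : Sample n, ((aggregator x z.1 : ℝ) - aggregator (optParam P) z.1) ^ 2 ≤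
      |(aggregator x z.1 : ℝ) - aggregator (optParam P) z.1| := fun z => by
    rw [← sq_abs, sq]
    exact mul_le_of_le_one_left (abs_nonneg _)
      (abs_sub_le_one_of_mem (aggregator x z.1).2 (aggregator _ z.1).2)
  have h1 : ∫ z, ((aggregator x z.1 : ℝ) - aggregator (optParam P) z.1) ^ 2 ∂(reportLaw P) ≤
      ∫ z, |(aggregator x z.1 : ℝ) - aggregator (optParam P) z.1| ∂(reportLaw P) :=
    integral_mono (integrable_sq_sub (hm _) (hm _)) hi.abs hsq
  refine h1.trans ?_
  rcases le_total x (optParam P) with hx | hx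
  · have : ∀ z : Sample n, |(aggregator x z.1 : ℝ) - aggregator (optParam P) z.1| =
        (aggregator x z.1 : ℝ) - aggregator (optParam P) z.1 := fun z =>
      abs_of_nonneg (sub_nonneg.2 (aggregator_antitone z.1 hx))
    simp_rw [this]
    exact le_abs_self _
  · have : ∀ z : Sample n, |(aggregator x z.1 : ℝ) - aggregator (optParam P) z.1| =
        -((aggregator x z.1 : ℝ) - aggregator (optParam P) z.1) := fun z =>
      abs_of_nonpos (sub_nonpos.2 (aggregator_antitone z.1 hx))
    simp_rw [this]
    rw [integral_neg]
    exact neg_le_abs _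

/-- One application of Hoeffding excludes every parameter with too large a mean discrepancy: these
all lie to the left of a point `x₂` of discrepancy exactly `ε`, and the empirical sum is antitone in
the parameter. -/
theorem exists_upper_test {μ : Measure (Sample n)} [IsProbabilityMeasure μ] {x₀ : ℝ}
    (h0 : meanGap μ x₀ = 0) {ε : ℝ} (hε : 0 < ε) {T : ℕ} (hT : 0 < T) :
    ∃ U : Set (Fin T → Sample n), MeasurableSet U ∧
      (Measure.pi fun _ => μ).real U ≤ Real.exp (-(T * (ε / 4) ^ 2 / 2)) ∧
      ∀ y ∉ U, ∀ x, ε < meanGap μ x → T * ε / 2 < sumGap x y := by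
  by_cases hex : ∃ x₁, ε < meanGap μ x₁
  · obtain ⟨x₁, h1⟩ := hex
    obtain ⟨x₂, h2⟩ := mem_range_of_exists_le_of_exists_ge (continuous_meanGap μ)
      ⟨x₀, h0.trans_le hε.le⟩ ⟨x₁, h1.le⟩
    refine ⟨{y | sumGap x₂ y ≤ T * (meanGap μ x₂ - ε / 2)},
      measurableSet_le (measurable_sumGap x₂) measurable_const,
      (hoeffding_lower (measurable_gap x₂) (abs_gap_le_one x₂) hT (by positivity)).trans ?_,
      fun y hy x hx => ?_⟩
    -- The deviation here is `ε / 2`; the weaker bound with `ε / 4` matches the one in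
    -- `exists_grid_test`.
    · gcongr
      norm_num
    · have hlt : x < x₂ := (antitone_meanGap μ).reflect_lt (h2.trans_lt hx)
      simp only [Set.mem_ofPred_eq, not_le] at hy
      refine lt_of_lt_of_le ?_ (sumGap_antitone y hlt.le)
      rw [h2] at hy
      linarith
  · exact ⟨∅, .empty, by simp [Real.exp_nonneg], fun y _ x hx => absurd ⟨x, hx⟩ hex⟩

theorem exists_lower_test {μ : Measure (Sample n)} [IsProbabilityMeasure μ] {x₀ : ℝ}
    (h0 : meanGap μ x₀ = 0) {ε : ℝ} (hε : 0 < ε) {T : ℕ} (hT : 0 < T) :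
    ∃ U : Set (Fin T → Sample n), MeasurableSet U ∧
      (Measure.pi fun _ => μ).real U ≤ Real.exp (-(T * (ε / 4) ^ 2 / 2)) ∧
      ∀ y ∉ U, ∀ x, meanGap μ x < -ε → sumGap x y < -(T * ε / 2) := by
  by_cases hex : ∃ x₁, meanGap μ x₁ < -ε
  · obtain ⟨x₁, h1⟩ := hex
    obtain ⟨x₂, h2⟩ := mem_range_of_exists_le_of_exists_ge (continuous_meanGap μ)
      ⟨x₁, h1.le⟩ ⟨x₀, (by linarith : -ε ≤ meanGap μ x₀)⟩
    refine ⟨{y | T * (meanGap μ x₂ + ε / 2) ≤ sumGap x₂ y},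
      measurableSet_le measurable_const (measurable_sumGap x₂),
      (hoeffding_upper (measurable_gap x₂) (abs_gap_le_one x₂) hT (by positivity)).trans ?_,
      fun y hy x hx => ?_⟩
    · gcongr
      norm_num
    · have hlt : x₂ < x := (antitone_meanGap μ).reflect_lt (hx.trans_eq h2.symm)
      simp only [Set.mem_ofPred_eq, not_le] at hy
      refine lt_of_le_of_lt (sumGap_antitone y hlt.le) ?_
      rw [h2] at hy
      linarith
  · exact ⟨∅, .empty, by simp [Real.exp_nonneg], fun y _ x hx => absurd ⟨x, hx⟩ hex⟩

/-- This ensures that the search of the learner succeeds. By continuity some point of the dense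
sequence has mean discrepancy below `ε / 4`. That point depends on `μ` but not on the data, so
Hoeffding applies to it, and a deviation below `ε / 4` keeps it within `ε / 2`. -/
theorem exists_grid_test {μ : Measure (Sample n)} [IsProbabilityMeasure μ] {x₀ : ℝ}
    (h0 : meanGap μ x₀ = 0) {ε : ℝ} (hε : 0 < ε) {T : ℕ} (hT : 0 < T) :
    ∃ U : Set (Fin T → Sample n), MeasurableSet U ∧
      (Measure.pi fun _ => μ).real U ≤ 2 * Real.exp (-(T * (ε / 4) ^ 2 / 2)) ∧
      ∀ y ∉ U, ∃ k, |sumGap (TopologicalSpace.denseSeq ℝ k) y| ≤ T * ε / 2 := by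
  obtain ⟨k, hk⟩ : ∃ k, TopologicalSpace.denseSeq ℝ k ∈
      meanGap μ ⁻¹' Set.Ioo (-(ε / 4)) (ε / 4) :=
    (TopologicalSpace.denseRange_denseSeq ℝ).exists_mem_open
      (isOpen_Ioo.preimage (continuous_meanGap μ)) ⟨x₀, by
        rw [Set.mem_preimage, h0]
        constructor <;> linarith⟩
  set x := TopologicalSpace.denseSeq ℝ k
  have hT' : (0 : ℝ) < T := by exact_mod_cast hT
  refine ⟨{y | T * (meanGap μ x + ε / 4) ≤ sumGap x y} ∪
      {y | sumGap x y ≤ T * (meanGap μ x - ε / 4)},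
    (measurableSet_le measurable_const (measurable_sumGap x)).union
      (measurableSet_le (measurable_sumGap x) measurable_const), ?_, fun y hy => ⟨k, ?_⟩⟩
  · rw [two_mul]
    exact (measureReal_union_le _ _).trans (add_le_add
      (hoeffding_upper (measurable_gap x) (abs_gap_le_one x) hT (by positivity))
      (hoeffding_lower (measurable_gap x) (abs_gap_le_one x) hT (by positivity)))
  · simp only [Set.mem_union, Set.mem_ofPred_eq, not_or, not_le] at hy
    have h1 := mul_lt_mul_of_pos_left hk.1 hT'
    have h2 := mul_lt_mul_of_pos_left hk.2 hT'
    exact abs_le.2 ⟨by linarith, by linarith⟩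

end Discrepancy

/-! ### The learner and the upper bound -/

section GridLearner

variable {n T : ℕ}

/-- The parameter with index `k` balances the empirical forecasts against the empirical events, or no
parameter in the dense sequence does. -/
def Accepts (ε : ℝ) (y : Fin T → Sample n) (k : ℕ) : Prop :=
  |sumGap (TopologicalSpace.denseSeq ℝ k) y| ≤ T * ε / 2 ∨
    ∀ l, ¬ |sumGap (TopologicalSpace.denseSeq ℝ l) y| ≤ T * ε / 2

theorem exists_accepts (ε : ℝ) (y : Fin T → Sample n) : ∃ k, Accepts ε y k := by
  by_cases h : ∃ k, |sumGap (TopologicalSpace.denseSeq ℝ k) y| ≤ T * ε / 2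
  · exact h.imp fun k hk => Or.inl hk
  · exact ⟨0, Or.inr (not_exists.1 h)⟩

theorem measurableSet_accepts (ε : ℝ) (k : ℕ) :
    MeasurableSet {y : Fin T → Sample n | Accepts ε y k} := by
  have h : ∀ l, MeasurableSet {y : Fin T → Sample n |
      |sumGap (TopologicalSpace.denseSeq ℝ l) y| ≤ T * ε / 2} := fun l =>
    measurableSet_le (measurable_sumGap _).abs measurable_const
  have heq : {y : Fin T → Sample n | Accepts ε y k} =
      {y | |sumGap (TopologicalSpace.denseSeq ℝ k) y| ≤ T * ε / 2} ∪
        ⋂ l, {y | |sumGap (TopologicalSpace.denseSeq ℝ l) y| ≤ T * ε / 2}ᶜ := by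
    ext y
    simp [Accepts]
  rw [heq]
  exact (h k).union (MeasurableSet.iInter fun l => (h l).compl)

open Classical in
/-- The first accepted index. -/
noncomputable def gridIndex (ε : ℝ) (y : Fin T → Sample n) : ℕ := Nat.find (exists_accepts ε y)

theorem measurable_gridIndex (ε : ℝ) : Measurable (gridIndex (n := n) (T := T) ε) := by
  classical
  exact measurable_find (exists_accepts ε) (measurableSet_accepts ε)

theorem abs_sumGap_gridIndex {ε : ℝ} {y : Fin T → Sample n}
    (h : ∃ k, |sumGap (TopologicalSpace.denseSeq ℝ k) y| ≤ T * ε / 2) :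
    |sumGap (TopologicalSpace.denseSeq ℝ (gridIndex ε y)) y| ≤ T * ε / 2 := by
  classical
  rcases Nat.find_spec (exists_accepts ε y) with h1 | h1
  · exact h1
  · exact absurd h (not_exists.2 h1)

/-- The learner that outputs the first aggregator of the dense sequence whose mean forecast on the
data is within `ε / 2` of the frequency of the event. -/
noncomputable def gridLearner (n T : ℕ) (ε : ℝ) : Learner n T where
  Seed := Unit
  measurableSpaceSeed := inferInstance
  seedLaw := ⟨Measure.dirac (), inferInstance⟩
  output _ y := aggregator (TopologicalSpace.denseSeq ℝ (gridIndex ε y))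
  measurable_output := by
    have h : Measurable fun q : ℕ × Reports n =>
        aggregator (TopologicalSpace.denseSeq ℝ q.1) q.2 :=
      measurable_from_prod_countable_right fun k => by
        exact measurable_aggregator (TopologicalSpace.denseSeq ℝ k)
    exact h.comp (((measurable_gridIndex ε).comp (measurable_fst.comp measurable_snd)).prodMk
      (measurable_snd.comp measurable_snd))

variable {S : Fin n → Type*} [∀ i, MeasurableSpace (S i)]

theorem trainingLaw_apply_of_dirac {A : Learner n T} {s₀ : A.Seed} (P : Distribution S)
    (hA : (A.seedLaw : Measure A.Seed) = Measure.dirac s₀) {V : Set (Fin T → Sample n)} :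
    trainingLaw A P (Set.univ ×ˢ V) = Measure.pi (fun _ : Fin T => reportLaw P) V := by
  rw [trainingLaw, hA, Measure.prod_prod, measure_univ, one_mul]

/-- The factor `4` is `1 + 1 + 2`, from the failure probabilities of the upper, lower and grid
tests. Outside these three events the accepted parameter has mean discrepancy at most `ε` in
absolute value. -/
theorem samplesSuffice_of_exp_le (hn : 1 ≤ n) {ε δ : ℝ} (hε : 0 < ε) (hT : 0 < T)
    (h : 4 * Real.exp (-(T * (ε / 4) ^ 2 / 2)) ≤ δ) :
    SamplesSuffice (condIndepFamily S) ε δ T := by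
  refine ⟨gridLearner n T ε, fun P hP => ?_⟩
  have h0 := meanGap_optParam hn hP
  obtain ⟨U₁, hm₁, hU₁, ht₁⟩ := exists_upper_test h0 hε hT
  obtain ⟨U₂, hm₂, hU₂, ht₂⟩ := exists_lower_test h0 hε hT
  obtain ⟨U₃, hm₃, hU₃, ht₃⟩ := exists_grid_test h0 hε hT
  have hsub : Set.univ ×ˢ (U₁ ∪ U₂ ∪ U₃)ᶜ ⊆
      {x | IsEpsOptimal P ε ((gridLearner n T ε).output x.1 x.2)} := by
    rintro ⟨u, y⟩ ⟨-, hy⟩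
    simp only [Set.mem_compl_iff, Set.mem_union, not_or] at hy
    obtain ⟨⟨hy1, hy2⟩, hy3⟩ := hy
    have hk := abs_le.1 (abs_sumGap_gridIndex (ht₃ y hy3))
    refine isEpsOptimal_of_abs_meanGap_le hn hP (abs_le.2 ⟨?_, ?_⟩)
    · by_contra! hlt
      exact absurd (ht₂ y hy2 _ hlt) (not_lt.2 hk.1)
    · by_contra! hlt
      exact absurd (ht₁ y hy1 _ hlt) (not_lt.2 hk.2)
  refine le_trans ?_ (measure_mono hsub)
  rw [trainingLaw_apply_of_dirac (s₀ := ()) P rfl, ← ofReal_measureReal,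
    probReal_compl_eq_one_sub ((hm₁.union hm₂).union hm₃)]
  refine ENNReal.ofReal_le_ofReal (sub_le_sub_left ?_ 1)
  have h1 := measureReal_union_le (μ := Measure.pi fun _ : Fin T => reportLaw P) (U₁ ∪ U₂) U₃
  have h2 := measureReal_union_le (μ := Measure.pi fun _ : Fin T => reportLaw P) U₁ U₂
  linarith

/-- The report `1 / 2`. -/
noncomputable def halfReport : I := ⟨1 / 2, by norm_num, by norm_num⟩

/-- The learner that ignores the data and always forecasts `1 / 2`. -/
noncomputable def halfLearner (n T : ℕ) : Learner n T where
  Seed := Unit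
  measurableSpaceSeed := inferInstance
  seedLaw := ⟨Measure.dirac (), inferInstance⟩
  output _ _ _ := halfReport
  measurable_output := measurable_const

/-- Large `ε` needs separate treatment: the claimed bound tends to `0` as `ε` and `δ` tend to `1`,
so zero samples have to be enough there. -/
theorem samplesSuffice_of_quarter_le (hn : 1 ≤ n) {ε δ : ℝ} (hε : 1 / 4 ≤ ε) (hδ : 0 ≤ δ) :
    SamplesSuffice (condIndepFamily S) ε δ T := by
  refine ⟨halfLearner n T, fun P hP => ?_⟩
  have hall : Set.univ ×ˢ Set.univ ⊆
      {x | IsEpsOptimal P ε ((halfLearner n T).output x.1 x.2)} := fun x _ => by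
    rw [Set.mem_ofPred_eq, isEpsOptimal_iff hn hP]
    have hb : ∀ z : Sample n,
        (1 / 2 - (aggregator (optParam P) z.1 : ℝ)) ^ 2 ≤ 1 / 4 := fun z => by
      nlinarith [(aggregator (optParam P) z.1).2.1, (aggregator (optParam P) z.1).2.2]
    refine le_trans (integral_mono
      (integrable_sq_sub measurable_const (measurable_aggregator _)) (integrable_const _) hb) ?_
    simpa using hε
  refine le_trans ?_ (measure_mono hall)
  rw [trainingLaw_apply_of_dirac (s₀ := ()) P rfl, measure_univ, ← ENNReal.ofReal_one]
  exact ENNReal.ofReal_le_ofReal (by linarith)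

/-- The factor `ε` inside the logarithm serves only to absorb the `4`, as `4 * ε < 1`. The `32`
cancels `(ε / 4) ^ 2 / 2 = ε ^ 2 / 32`. -/
theorem four_mul_exp_le {ε δ t : ℝ} (hε : 0 < ε) (hε' : ε < 1 / 4) (hδ : 0 < δ)
    (ht : 32 * (1 / ε ^ 2 * Real.log (1 / (ε * δ))) ≤ t) :
    4 * Real.exp (-(t * (ε / 4) ^ 2 / 2)) ≤ δ := by
  have h1 : Real.log (1 / (ε * δ)) ≤ t * (ε / 4) ^ 2 / 2 := by
    rw [one_div_mul_eq_div, mul_div_assoc', div_le_iff₀ (by positivity)] at ht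
    linarith
  have h2 : Real.exp (-(t * (ε / 4) ^ 2 / 2)) ≤ ε * δ := by
    rw [Real.log_div one_ne_zero (by positivity), Real.log_one, zero_sub] at h1
    calc Real.exp (-(t * (ε / 4) ^ 2 / 2)) ≤ Real.exp (Real.log (ε * δ)) :=
          Real.exp_le_exp.2 (by linarith)
      _ = ε * δ := Real.exp_log (by positivity)
  nlinarith

theorem one_le_log_one_div {ε δ : ℝ} (hε : 0 < ε) (hε' : ε < 1 / 4) (hδ : 0 < δ) (hδ' : δ < 1) :
    1 ≤ Real.log (1 / (ε * δ)) := by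
  rw [Real.le_log_iff_exp_le (by positivity), le_div_iff₀ (by positivity)]
  have he := Real.exp_one_lt_d9
  have : ε * δ < 1 / 4 := by nlinarith
  have h0 : 0 < ε * δ := by positivity
  nlinarith

theorem sampleComplexity_le (hn : 1 ≤ n) {ε δ : ℝ} (hε : 0 < ε) (hδ : 0 < δ)
    (hδ' : δ < 1) :
    (sampleComplexity (condIndepFamily S) ε δ : ℝ≥0∞) ≤
      ENNReal.ofReal (33 * (1 / ε ^ 2 * Real.log (1 / (ε * δ)))) := by
  rcases le_or_gt (1 / 4) ε with h4 | h4
  · have : sampleComplexity (condIndepFamily S) ε δ = 0 :=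
      le_antisymm (iInf₂_le (0 : ℕ) fun T _ => samplesSuffice_of_quarter_le hn h4 hδ.le) bot_le
    simp [this]
  · set L := 1 / ε ^ 2 * Real.log (1 / (ε * δ)) with hL
    have hL1 : 1 ≤ L := by
      have h1 := one_le_log_one_div hε h4 hδ hδ'
      have h2 : 1 ≤ 1 / ε ^ 2 := by
        rw [le_div_iff₀ (by positivity)]
        nlinarith
      nlinarith
    have hle : sampleComplexity (condIndepFamily S) ε δ ≤ (⌈32 * L⌉₊ : ℕ∞) := by
      refine iInf₂_le ⌈32 * L⌉₊ fun T hT => ?_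
      have hT' : 32 * L ≤ T := Nat.ceil_le.1 hT
      refine samplesSuffice_of_exp_le hn hε ?_ (four_mul_exp_le hε h4 hδ hT')
      exact_mod_cast (by linarith : (0 : ℝ) < T)
    -- Since `L ≥ 1`, rounding up costs at most one more `L`.
    have hceil : (⌈32 * L⌉₊ : ℝ) ≤ 33 * L := by
      linarith [Nat.ceil_lt_add_one (by linarith : 0 ≤ 32 * L)]
    calc (sampleComplexity (condIndepFamily S) ε δ : ℝ≥0∞)
        ≤ ((⌈32 * L⌉₊ : ℕ∞) : ℝ≥0∞) := ENat.toENNReal_le.2 hle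
      _ = ENNReal.ofReal (⌈32 * L⌉₊ : ℝ) := by simp
      _ ≤ _ := ENNReal.ofReal_le_ofReal hceil

end GridLearner

/-! ### Chi-square bounds in dual form -/

section ChiSquare

variable {α β : Type*} [MeasurableSpace α] [MeasurableSpace β]

/-- A dual form of the bound `χ²(Q ∥ P) + 1 ≤ K`. -/
def ChiSqBound (K : ℝ≥0∞) (Q P : Measure α) : Prop :=
  ∀ f : α → ℝ≥0∞, Measurable f → (∫⁻ a, f a ∂Q) ^ 2 ≤ K * ∫⁻ a, f a ^ 2 ∂P

theorem chiSqBound_self (μ : Measure α) [IsProbabilityMeasure μ] : ChiSqBound 1 μ μ := by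
  intro f hf
  have h := ENNReal.lintegral_mul_le_Lp_mul_Lq μ
    (Real.HolderConjugate.two_two) hf.aemeasurable (measurable_const (a := (1 : ℝ≥0∞))).aemeasurable
  simp only [Pi.mul_apply, lintegral_const, measure_univ,
    ENNReal.rpow_ofNat, one_pow, ENNReal.one_rpow, mul_one] at h
  calc (∫⁻ a, f a ∂μ) ^ 2 ≤ ((∫⁻ a, f a ^ 2 ∂μ) ^ (1 / (2 : ℝ))) ^ 2 := pow_le_pow_left' h 2
    _ = 1 * ∫⁻ a, f a ^ 2 ∂μ := by
      rw [← ENNReal.rpow_natCast, ← ENNReal.rpow_mul]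
      norm_num

/-- The form used at the end: an event that is likely under `Q` cannot be too unlikely under `P`. -/
theorem ChiSqBound.apply_sq_le {K : ℝ≥0∞} {Q P : Measure α} (h : ChiSqBound K Q P) {E : Set α}
    (hE : MeasurableSet E) : Q E ^ 2 ≤ K * P E := by
  have h1 := h (E.indicator fun _ => 1) (measurable_const.indicator hE)
  have h2 : (fun a => E.indicator (fun _ => (1 : ℝ≥0∞)) a ^ 2) = E.indicator fun _ => 1 := by
    funext a
    by_cases ha : a ∈ E <;> simp [ha]
  rw [h2] at h1
  simpa [lintegral_indicator hE] using h1

theorem ChiSqBound.map {K : ℝ≥0∞} {Q P : Measure α} (h : ChiSqBound K Q P) {g : α → β}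
    (hg : Measurable g) : ChiSqBound K (Q.map g) (P.map g) := by
  intro f hf
  rw [lintegral_map hf hg, lintegral_map (hf.pow_const 2) hg]
  exact h _ (hf.comp hg)

/-- In dual form tensorisation needs no densities: the first bound applies to the inner integral as
a function of the first coordinate, the second one to each section. -/
theorem ChiSqBound.prod {K K' : ℝ≥0∞} {Q P : Measure α} {Q' P' : Measure β} [SFinite Q']
    [SFinite P'] (h : ChiSqBound K Q P) (h' : ChiSqBound K' Q' P') :
    ChiSqBound (K * K') (Q.prod Q') (P.prod P') := by
  intro f hf
  rw [lintegral_prod _ hf.aemeasurable, lintegral_prod _ (hf.pow_const 2).aemeasurable]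
  refine (h _ hf.lintegral_prod_right').trans ?_
  rw [mul_assoc, ← lintegral_const_mul _ (hf.pow_const 2).lintegral_prod_right']
  gcongr with a
  exact h' _ (hf.comp measurable_prodMk_left)

theorem ChiSqBound.pi {K : ℝ≥0∞} {Q P : Measure α} [SigmaFinite Q] [SigmaFinite P]
    (h : ChiSqBound K Q P) (n : ℕ) :
    ChiSqBound (K ^ n) (Measure.pi fun _ : Fin n => Q) (Measure.pi fun _ : Fin n => P) := by
  induction n with
  | zero =>
    intro f hf
    rw [Measure.pi_of_empty (fun _ : Fin 0 => Q) Fin.elim0,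
      Measure.pi_of_empty (fun _ : Fin 0 => P) Fin.elim0, lintegral_dirac' _ hf,
      lintegral_dirac' _ (hf.pow_const 2), pow_zero, one_mul]
  | succ n ih =>
    have h1 := (h.prod ih).map
      (MeasurableEquiv.piFinSuccAbove (fun _ : Fin (n + 1) => α) 0).symm.measurable
    have hQ := ((measurePreserving_piFinSuccAbove (fun _ : Fin (n + 1) => Q) 0).symm).map_eq
    have hP := ((measurePreserving_piFinSuccAbove (fun _ : Fin (n + 1) => P) 0).symm).map_eq
    rw [pow_succ', ← hQ, ← hP]
    exact h1

/-- Cauchy–Schwarz for two terms, applied to `a' * √(k / a) * √(a * X)` and its counterpart in `b`;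
the cross terms are compared by AM-GM. It gives the chi-square bound for mixtures. -/
theorem sq_add_le_mul_add {a b a' b' k l x y X Y : ℝ} (ha : 0 < a) (hb : 0 < b) (hk : 0 ≤ k)
    (hl : 0 ≤ l) (hX : 0 ≤ X) (hY : 0 ≤ Y)
    (hx : x ^ 2 ≤ k * X) (hy : y ^ 2 ≤ l * Y) :
    (a' * x + b' * y) ^ 2 ≤ (a' ^ 2 / a * k + b' ^ 2 / b * l) * (a * X + b * Y) := by
  have e : (a' ^ 2 / a * k + b' ^ 2 / b * l) * (a * X + b * Y) =
      a' ^ 2 * (k * X) + b' ^ 2 * (l * Y) +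
        (a' ^ 2 / a * k * (b * Y) + b' ^ 2 / b * l * (a * X)) := by
    field_simp
    ring
  have cross : 2 * (a' * b' * (x * y)) ≤
      a' ^ 2 / a * k * (b * Y) + b' ^ 2 / b * l * (a * X) := by
    refine le_of_sq_le_sq ?_ (by positivity)
    have h4 := four_mul_le_sq_add (a' ^ 2 / a * k * (b * Y)) (b' ^ 2 / b * l * (a * X))
    have hp : a' ^ 2 / a * k * (b * Y) * (b' ^ 2 / b * l * (a * X)) =
        a' ^ 2 * b' ^ 2 * ((k * X) * (l * Y)) := by
      field_simp
    have hm : x ^ 2 * y ^ 2 ≤ (k * X) * (l * Y) := mul_le_mul hx hy (by positivity) (by positivity)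
    have hm' := mul_le_mul_of_nonneg_left hm (by positivity : 0 ≤ a' ^ 2 * b' ^ 2)
    nlinarith
  have h1 := mul_le_mul_of_nonneg_left hx (sq_nonneg a')
  have h2 := mul_le_mul_of_nonneg_left hy (sq_nonneg b')
  rw [e]
  linarith [cross, h1, h2]

theorem ennreal_sq_add_le_mul_add {a b a' b' k l : ℝ} {x y X Y : ℝ≥0∞} (ha : 0 < a) (hb : 0 < b)
    (ha' : 0 < a') (hk : 0 < k) (hb' : 0 < b') (hl : 0 < l) (hx : x ^ 2 ≤ ENNReal.ofReal k * X)
    (hy : y ^ 2 ≤ ENNReal.ofReal l * Y) :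
    (ENNReal.ofReal a' * x + ENNReal.ofReal b' * y) ^ 2 ≤
      ENNReal.ofReal (a' ^ 2 / a * k + b' ^ 2 / b * l) *
        (ENNReal.ofReal a * X + ENNReal.ofReal b * Y) := by
  have hc : 0 < a' ^ 2 / a * k + b' ^ 2 / b * l := by positivity
  rcases eq_or_ne X ⊤ with rfl | hX
  · simp [ENNReal.mul_top, ha, hc]
  rcases eq_or_ne Y ⊤ with rfl | hY
  · simp [ENNReal.mul_top, hb, hc]
  have hxt : x ≠ ⊤ := by
    rintro rfl
    simp [ENNReal.mul_eq_top, hX] at hx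
  have hyt : y ≠ ⊤ := by
    rintro rfl
    simp [ENNReal.mul_eq_top, hY] at hy
  have key := sq_add_le_mul_add (a' := a') (b' := b') ha hb hk.le hl.le
    (ENNReal.toReal_nonneg (a := X)) (ENNReal.toReal_nonneg (a := Y))
    (by simpa [ENNReal.toReal_ofReal hk.le] using
      ENNReal.toReal_mono (ENNReal.mul_ne_top ENNReal.ofReal_ne_top hX) hx)
    (by simpa [ENNReal.toReal_ofReal hl.le] using
      ENNReal.toReal_mono (ENNReal.mul_ne_top ENNReal.ofReal_ne_top hY) hy)
  have h := ENNReal.ofReal_le_ofReal key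
  rwa [ENNReal.ofReal_pow (by positivity), ENNReal.ofReal_mul hc.le,
    ENNReal.ofReal_add (by positivity) (by positivity),
    ENNReal.ofReal_add (p := a * _) (by positivity) (by positivity),
    ENNReal.ofReal_mul ha'.le, ENNReal.ofReal_mul hb'.le, ENNReal.ofReal_mul ha.le,
    ENNReal.ofReal_mul hb.le, ENNReal.ofReal_toReal hxt, ENNReal.ofReal_toReal hyt,
    ENNReal.ofReal_toReal hX, ENNReal.ofReal_toReal hY] at h

/-- The mixture of two measures with weights `a` and `1 - a`. -/
noncomputable def mix (a : ℝ) (μ ν : Measure α) : Measure α :=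
  ENNReal.ofReal a • μ + ENNReal.ofReal (1 - a) • ν

theorem lintegral_mix (a : ℝ) (μ ν : Measure α) (f : α → ℝ≥0∞) :
    ∫⁻ x, f x ∂(mix a μ ν) =
      ENNReal.ofReal a * ∫⁻ x, f x ∂μ + ENNReal.ofReal (1 - a) * ∫⁻ x, f x ∂ν := by
  rw [mix, lintegral_add_measure, lintegral_smul_measure, lintegral_smul_measure]
  rfl

theorem mix_apply (a : ℝ) (μ ν : Measure α) (s : Set α) :
    mix a μ ν s = ENNReal.ofReal a * μ s + ENNReal.ofReal (1 - a) * ν s := rfl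

theorem map_mix (a : ℝ) (μ ν : Measure α) {g : α → β} (hg : Measurable g) :
    (mix a μ ν).map g = mix a (μ.map g) (ν.map g) := by
  rw [mix, mix, Measure.map_add _ _ hg, Measure.map_smul, Measure.map_smul]

theorem isProbabilityMeasure_mix {a : ℝ} (h0 : 0 ≤ a) (h1 : a ≤ 1) (μ ν : Measure α)
    [IsProbabilityMeasure μ] [IsProbabilityMeasure ν] : IsProbabilityMeasure (mix a μ ν) := ⟨by
  rw [mix_apply, measure_univ, measure_univ, mul_one, mul_one,
    ← ENNReal.ofReal_add h0 (by linarith)]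
  simp⟩

instance (a : ℝ) (μ ν : Measure α) [IsFiniteMeasure μ] [IsFiniteMeasure ν] :
    IsFiniteMeasure (mix a μ ν) := ⟨by
  rw [mix_apply]
  exact ENNReal.add_lt_top.2 ⟨ENNReal.mul_lt_top ENNReal.ofReal_lt_top (measure_lt_top _ _),
    ENNReal.mul_lt_top ENNReal.ofReal_lt_top (measure_lt_top _ _)⟩⟩

theorem ChiSqBound.mix {a a' k l : ℝ} {Q Q' P P' : Measure α} (ha : a ∈ Set.Ioo (0 : ℝ) 1)
    (ha' : a' ∈ Set.Ioo (0 : ℝ) 1) (hk : 0 < k) (hl : 0 < l)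
    (h : ChiSqBound (ENNReal.ofReal k) Q P) (h' : ChiSqBound (ENNReal.ofReal l) Q' P') :
    ChiSqBound (ENNReal.ofReal (a' ^ 2 / a * k + (1 - a') ^ 2 / (1 - a) * l))
      (mix a' Q Q') (mix a P P') := by
  intro f hf
  rw [lintegral_mix, lintegral_mix]
  exact ennreal_sq_add_le_mul_add ha.1 (sub_pos.2 ha.2) ha'.1 hk (sub_pos.2 ha'.2) hl
    (h f hf) (h' f hf)

end ChiSquare

/-! ### Conditionally independent laws with prescribed signal laws -/

section JointLaw

variable {n : ℕ} {X Y : Fin n → Type*} [∀ i, MeasurableSpace (X i)] [∀ i, MeasurableSpace (Y i)]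

/-- The law under which the event is `true` with probability `p` and, given the value `v` of the
event, the signals are independent with laws `ν v i`. -/
noncomputable def jointLaw (p : ℝ) (ν : Bool → ∀ i, Measure (X i)) :
    Measure ((∀ i, X i) × Bool) :=
  mix p ((Measure.pi (ν true)).prod (Measure.dirac true))
    ((Measure.pi (ν false)).prod (Measure.dirac false))

variable (p : ℝ) (ν : Bool → ∀ i, Measure (X i))

theorem jointLaw_prod_singleton (E : Set (∀ i, X i)) (v : Bool) :
    jointLaw p ν (E ×ˢ {v}) =
      ENNReal.ofReal (if v then p else 1 - p) * Measure.pi (ν v) E := by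
  rw [jointLaw, mix_apply, Measure.prod_prod, Measure.prod_prod]
  cases v <;> simp

variable [∀ v i, IsProbabilityMeasure (ν v i)]

theorem isProbabilityMeasure_jointLaw {p : ℝ} (hp : p ∈ Set.Ioo (0 : ℝ) 1) :
    IsProbabilityMeasure (jointLaw p ν) :=
  isProbabilityMeasure_mix hp.1.le hp.2.le _ _

theorem setOf_event_eq {α : Type*} (v : Bool) :
    {x : α × Bool | x.2 = v} = Set.univ ×ˢ {v} := by
  ext x
  simp

theorem jointLaw_event (v : Bool) :
    jointLaw p ν {x | x.2 = v} = ENNReal.ofReal (if v then p else 1 - p) := by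
  rw [setOf_event_eq, jointLaw_prod_singleton, measure_univ, mul_one]

theorem map_jointLaw {f : ∀ i, X i → Y i} (hf : ∀ i, Measurable (f i)) :
    (jointLaw p ν).map (fun x => (fun i => f i (x.1 i), x.2)) =
      jointLaw p (fun v i => (ν v i).map (f i)) := by
  have hF : Measurable fun x : ∀ i, X i => fun i => f i (x i) :=
    measurable_pi_iff.2 fun i => (hf i).comp (measurable_pi_apply i)
  have : ∀ v i, IsProbabilityMeasure ((ν v i).map (f i)) := fun v i =>
    Measure.isProbabilityMeasure_map (hf i).aemeasurable
  have hmap : ∀ v, ((Measure.pi (ν v)).prod (Measure.dirac v)).map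
      (Prod.map (fun x : ∀ i, X i => fun i => f i (x i)) id) =
      (Measure.pi fun i => (ν v i).map (f i)).prod (Measure.dirac v) := fun v => by
    rw [← Measure.map_prod_map _ _ hF measurable_id, Measure.map_id,
      Measure.pi_map_pi fun i => (hf i).aemeasurable]
  change (jointLaw p ν).map (Prod.map (fun x : ∀ i, X i => fun i => f i (x i)) id) = _
  rw [jointLaw, map_mix _ _ _ (hF.prodMap measurable_id), hmap, hmap]
  rfl

theorem lintegral_jointLaw_eval (i : Fin n) {f : X i → ℝ≥0∞} (hf : Measurable f) :
    ∫⁻ x, f (x.1 i) ∂(jointLaw p ν) =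
      ENNReal.ofReal p * ∫⁻ s, f s ∂(ν true i) + ENNReal.ofReal (1 - p) * ∫⁻ s, f s ∂(ν false i) := by
  have h : ∀ v, ∫⁻ x, f (x.1 i) ∂((Measure.pi (ν v)).prod (Measure.dirac v)) =
      ∫⁻ s, f s ∂(ν v i) := fun v => by
    rw [← (measurePreserving_eval (ν v) i).lintegral_comp hf]
    exact (measurePreserving_fst (μ := Measure.pi (ν v)) (ν := Measure.dirac v)).lintegral_comp
      (hf.comp (measurable_pi_apply i))
  rw [jointLaw, lintegral_mix, h, h]

theorem jointLaw_eval_inter_event (i : Fin n) {D : Set (X i)} (hD : MeasurableSet D) (v : Bool) :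
    jointLaw p ν ((fun x => x.1 i) ⁻¹' D ∩ {x | x.2 = v}) =
      ENNReal.ofReal (if v then p else 1 - p) * ν v i D := by
  have : (fun x : (∀ i, X i) × Bool => x.1 i) ⁻¹' D ∩ {x | x.2 = v} =
      (Function.eval i ⁻¹' D) ×ˢ {v} := by
    ext x
    simp
  rw [this, jointLaw_prod_singleton,
    (measurePreserving_eval (ν v) i).measure_preimage hD.nullMeasurableSet]

theorem cond_jointLaw {p : ℝ} (hp : p ∈ Set.Ioo (0 : ℝ) 1) (v : Bool) :
    ProbabilityTheory.cond (jointLaw p ν) {x | x.2 = v} =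
      (Measure.pi (ν v)).prod (Measure.dirac v) := by
  classical
  have hw : 0 < if v then p else 1 - p := by
    cases v
    · simpa using hp.2
    · simpa using hp.1
  have hr : (jointLaw p ν).restrict {x | x.2 = v} =
      ENNReal.ofReal (if v then p else 1 - p) •
        (Measure.pi (ν v)).prod (Measure.dirac v) := by
    rw [setOf_event_eq, jointLaw, mix, Measure.restrict_add, Measure.restrict_smul,
      Measure.restrict_smul, ← Measure.prod_restrict, ← Measure.prod_restrict,
      restrict_dirac' (measurableSet_singleton v),
      restrict_dirac' (measurableSet_singleton v), Measure.restrict_univ,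
      Measure.restrict_univ]
    cases v <;> simp
  rw [ProbabilityTheory.cond, jointLaw_event, hr, smul_smul,
    ENNReal.inv_mul_cancel (by simpa using hw) ENNReal.ofReal_ne_top, one_smul]

theorem iIndepFun_cond_jointLaw {p : ℝ} (hp : p ∈ Set.Ioo (0 : ℝ) 1) (v : Bool) :
    iIndepFun (fun (i : Fin n) (x : (∀ j, X j) × Bool) => x.1 i)
      (ProbabilityTheory.cond (jointLaw p ν) {x | x.2 = v}) := by
  have hm : ∀ i : Fin n, Measurable fun x : (∀ j, X j) × Bool => x.1 i := fun i =>
    (measurable_pi_apply i).comp measurable_fst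
  rw [cond_jointLaw ν hp, iIndepFun_iff_map_fun_eq_pi_map fun i => (hm i).aemeasurable]
  have hfst := measurePreserving_fst (μ := Measure.pi (ν v)) (ν := Measure.dirac v)
  refine hfst.map_eq.trans ?_
  congr 1
  funext i
  exact ((measurePreserving_eval (ν v) i).comp hfst).map_eq.symm

end JointLaw

/-! ### The hard instance -/

section HardLaw

/-- The law of a signal given the value `v` of the event: the signal is `a` with probability `β` if
the event is `false`, and otherwise it is `b`. -/
noncomputable def signalLaw {α : Type*} [MeasurableSpace α] (β : ℝ) (a b : α) (v : Bool) :
    Measure α :=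
  if v then Measure.dirac b else mix β (Measure.dirac a) (Measure.dirac b)

theorem isProbabilityMeasure_signalLaw {α : Type*} [MeasurableSpace α] {β : ℝ}
    (hβ : β ∈ Set.Ioo (0 : ℝ) 1) (a b : α) (v : Bool) :
    IsProbabilityMeasure (signalLaw β a b v) := by
  cases v
  · exact isProbabilityMeasure_mix hβ.1.le hβ.2.le _ _
  · exact Measure.dirac.isProbabilityMeasure

theorem map_signalLaw {α γ : Type*} [MeasurableSpace α] [MeasurableSpace γ] (β : ℝ) (a b : α)
    (v : Bool) {f : α → γ} (hf : Measurable f) :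
    (signalLaw β a b v).map f = signalLaw β (f a) (f b) v := by
  cases v
  · simp only [signalLaw, Bool.false_eq_true, if_false]
    rw [map_mix _ _ _ hf, Measure.map_dirac' hf, Measure.map_dirac' hf]
  · simp only [signalLaw, if_true]
    rw [Measure.map_dirac' hf]

/-- The prior for which the signal `b` of `signalLaw β a b` is uninformative about the event. -/
noncomputable def hardPrior (β : ℝ) : ℝ := (1 - β) / (2 - β)

theorem one_sub_hardPrior {β : ℝ} (hβ : β < 1) : 1 - hardPrior β = 1 / (2 - β) := by
  have : 2 - β ≠ 0 := by linarith
  rw [hardPrior]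
  field_simp
  ring

theorem hardPrior_mem {β : ℝ} (hβ : β ∈ Set.Ioo (0 : ℝ) 1) :
    hardPrior β ∈ Set.Ioo (0 : ℝ) 1 := by
  have h1 : 0 < 1 - β := by linarith [hβ.2]
  have h2 : 0 < 2 - β := by linarith [hβ.2]
  refine ⟨div_pos h1 h2, ?_⟩
  rw [hardPrior, div_lt_one h2]
  linarith

theorem hardPrior_div {β : ℝ} (hβ : β ∈ Set.Ioo (0 : ℝ) 1) :
    hardPrior β / (1 - hardPrior β) = 1 - β := by
  have : 2 - β ≠ 0 := by linarith [hβ.2]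
  rw [one_sub_hardPrior hβ.2, hardPrior]
  field_simp

variable {n : ℕ}

/-- The laws of the signals of all experts in the hard instance. -/
noncomputable def hardSignals {X : Fin n → Type*} [∀ i, MeasurableSpace (X i)] (a b : ∀ i, X i)
    (β : ℝ) (v : Bool) (i : Fin n) : Measure (X i) :=
  signalLaw β (a i) (b i) v

theorem isProbabilityMeasure_hardSignals {X : Fin n → Type*} [∀ i, MeasurableSpace (X i)]
    (a b : ∀ i, X i) {β : ℝ} (hβ : β ∈ Set.Ioo (0 : ℝ) 1) (v : Bool) (i : Fin n) :
    IsProbabilityMeasure (hardSignals a b β v i) :=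
  isProbabilityMeasure_signalLaw hβ _ _ _

/-- The law of the reports and the event in the hard instance with parameter `β`. -/
noncomputable def hardLaw (n : ℕ) (β : ℝ) : Measure (Sample n) :=
  jointLaw (hardPrior β) (hardSignals (fun _ => (0 : I)) (fun _ => halfReport) β)

theorem isProbabilityMeasure_hardLaw (n : ℕ) {β : ℝ} (hβ : β ∈ Set.Ioo (0 : ℝ) 1) :
    IsProbabilityMeasure (hardLaw n β) := by
  have := isProbabilityMeasure_hardSignals (fun _ : Fin n => (0 : I)) (fun _ => halfReport) hβ
  exact isProbabilityMeasure_jointLaw _ (hardPrior_mem hβ)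

variable {S : Fin n → Type*} [∀ i, MeasurableSpace (S i)]

/-- The hard instance: the signals take two values `a i` and `b i`. -/
noncomputable def hardDistribution (a b : ∀ i, S i) {β : ℝ} (hβ : β ∈ Set.Ioo (0 : ℝ) 1) :
    Distribution S :=
  ⟨jointLaw (hardPrior β) (hardSignals a b β), by
    have := isProbabilityMeasure_hardSignals a b hβ
    exact isProbabilityMeasure_jointLaw (hardSignals a b β) (hardPrior_mem hβ)⟩

theorem prior_hardDistribution (a b : ∀ i, S i) {β : ℝ} (hβ : β ∈ Set.Ioo (0 : ℝ) 1) :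
    prior (hardDistribution a b hβ) true = ENNReal.ofReal (hardPrior β) := by
  have := isProbabilityMeasure_hardSignals a b hβ
  exact jointLaw_event (hardPrior β) (hardSignals a b β) true

theorem hardDistribution_mem (a b : ∀ i, S i) {β : ℝ} (hβ : β ∈ Set.Ioo (0 : ℝ) 1) :
    hardDistribution a b hβ ∈ condIndepFamily S := by
  have := isProbabilityMeasure_hardSignals a b hβ
  refine ⟨?_, fun v => iIndepFun_cond_jointLaw (hardSignals a b β) (hardPrior_mem hβ) v⟩
  have h : (prior (hardDistribution a b hβ) true).toReal = hardPrior β := by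
    rw [prior_hardDistribution, ENNReal.toReal_ofReal (hardPrior_mem hβ).1.le]
  have h' := hardPrior_mem hβ
  rw [← h] at h'
  exact h'

variable {a b : ∀ i, S i} {A : ∀ i, Set (S i)}

/-- Calibration written out at the two atoms. Singletons need not be measurable in `S i`, so the
values of the report at `a i` and at `b i` are isolated by taking for `D` a measurable set that
separates the two points, and then its complement. -/
theorem lintegral_weight_hardDistribution {β : ℝ} (hβ : β ∈ Set.Ioo (0 : ℝ) 1) (i : Fin n)
    {D : Set (S i)} (hD : MeasurableSet D) :
    let w := D.indicator fun s => weight true (report (hardDistribution a b hβ) i s)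
    ENNReal.ofReal (hardPrior β) * w (b i) + ENNReal.ofReal (1 - hardPrior β) *
        (ENNReal.ofReal β * w (a i) + ENNReal.ofReal (1 - β) * w (b i)) =
      ENNReal.ofReal (hardPrior β) * D.indicator 1 (b i) := by
  intro w
  have := isProbabilityMeasure_hardSignals a b hβ
  have hw : Measurable w :=
    ((measurable_weight true).comp (measurable_report _ i)).indicator hD
  have h := setLIntegral_weight_report (hardDistribution a b hβ) i true hD
  have hev : Measurable fun x : (∀ j, S j) × Bool => x.1 i :=
    (measurable_pi_apply i).comp measurable_fst
  rw [← lintegral_indicator (hev hD)] at h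
  have hl : ∫⁻ x, w (x.1 i) ∂(hardDistribution a b hβ : Measure ((∀ j, S j) × Bool)) =
      ENNReal.ofReal (hardPrior β) * w (b i) + ENNReal.ofReal (1 - hardPrior β) *
        (ENNReal.ofReal β * w (a i) + ENNReal.ofReal (1 - β) * w (b i)) := by
    refine (lintegral_jointLaw_eval (hardPrior β) (hardSignals a b β) i hw).trans ?_
    simp only [hardSignals, signalLaw, if_true, Bool.false_eq_true, if_false]
    rw [lintegral_mix, lintegral_dirac' _ hw, lintegral_dirac' _ hw]
  rw [← hl]
  refine h.trans ((jointLaw_eval_inter_event (hardPrior β) (hardSignals a b β) i hD true).trans ?_)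
  simp [hardSignals, signalLaw, Measure.dirac_apply' _ hD]

theorem report_hardDistribution_left {β : ℝ} (hβ : β ∈ Set.Ioo (0 : ℝ) 1) (i : Fin n)
    (hA : MeasurableSet (A i)) (ha : a i ∈ A i) (hb : b i ∉ A i) :
    report (hardDistribution a b hβ) i (a i) = 0 := by
  have h := lintegral_weight_hardDistribution (a := a) (b := b) hβ i hA
  simp only [Set.indicator_of_mem ha, Set.indicator_of_notMem hb, mul_zero, zero_add,
    add_zero, mul_eq_zero, ENNReal.ofReal_eq_zero, not_le.2 hβ.1, false_or,
    not_le.2 (sub_pos.2 (hardPrior_mem hβ).2)] at h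
  have h0 : ((report (hardDistribution a b hβ) i (a i) : I) : ℝ) ≤ 0 := by
    simpa [weight] using h
  exact Subtype.ext (le_antisymm h0 (report (hardDistribution a b hβ) i (a i)).2.1)

theorem report_hardDistribution_right {β : ℝ} (hβ : β ∈ Set.Ioo (0 : ℝ) 1) (i : Fin n)
    (hA : MeasurableSet (A i)) (ha : a i ∈ A i) (hb : b i ∉ A i) :
    report (hardDistribution a b hβ) i (b i) = halfReport := by
  have h := lintegral_weight_hardDistribution (a := a) (b := b) hβ i hA.compl
  have hb' : b i ∈ (A i)ᶜ := hb
  have ha' : a i ∉ (A i)ᶜ := fun h => h ha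
  obtain ⟨hp0, hp1⟩ := hardPrior_mem hβ
  simp only [Set.indicator_of_mem hb', Set.indicator_of_notMem ha', mul_zero, zero_add,
    Pi.one_apply, mul_one] at h
  have hr := (report (hardDistribution a b hβ) i (b i)).2.1
  have hq : 0 ≤ 1 - hardPrior β := by linarith
  have hβ1 : 0 ≤ 1 - β := by linarith [hβ.2]
  simp only [weight, if_true] at h
  rw [← ENNReal.ofReal_mul hβ1, ← ENNReal.ofReal_mul hq, ← ENNReal.ofReal_mul hp0.le,
    ← ENNReal.ofReal_add (by positivity) (by positivity),
    ENNReal.ofReal_eq_ofReal_iff (by positivity) hp0.le] at h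
  have h2 : (1 - hardPrior β) * (1 - β) = hardPrior β := by
    have := hardPrior_div hβ
    rw [div_eq_iff (by linarith)] at this
    linarith
  refine Subtype.ext ?_
  change ((report (hardDistribution a b hβ) i (b i) : I) : ℝ) = 1 / 2
  have h3 : hardPrior β * (2 * ((report (hardDistribution a b hβ) i (b i) : I) : ℝ)) =
      hardPrior β * 1 := by
    rw [← mul_assoc, h2] at h
    linarith
  have := mul_left_cancel₀ hp0.ne' h3
  linarith

/-- The learner sees a law that no longer depends on the signal spaces. -/
theorem reportLaw_hardDistribution {β : ℝ} (hβ : β ∈ Set.Ioo (0 : ℝ) 1)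
    (hA : ∀ i, MeasurableSet (A i)) (ha : ∀ i, a i ∈ A i) (hb : ∀ i, b i ∉ A i) :
    reportLaw (hardDistribution a b hβ) = hardLaw n β := by
  have := isProbabilityMeasure_hardSignals a b hβ
  refine (map_jointLaw (hardPrior β) (hardSignals a b β) fun i => measurable_report (hardDistribution a b hβ) i).trans ?_
  rw [hardLaw]
  congr 1
  funext v i
  rw [hardSignals, hardSignals, map_signalLaw _ _ _ _ (measurable_report _ i),
    report_hardDistribution_left hβ i (hA i) (ha i) (hb i),
    report_hardDistribution_right hβ i (hA i) (ha i) (hb i)]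

/-- When the event is `true`, all signals are `b`, hence all reports are `1 / 2`. -/
theorem hardPrior_le_hardLaw_real {β : ℝ} (hβ : β ∈ Set.Ioo (0 : ℝ) 1) :
    hardPrior β ≤ (hardLaw n β).real {z | z.1 = fun _ => halfReport} := by
  have hprob := isProbabilityMeasure_hardLaw n hβ
  rw [measureReal_def, ← ENNReal.ofReal_le_iff_le_toReal (measure_ne_top _ _)]
  have hsub : ({fun _ => halfReport} : Set (Reports n)) ×ˢ {true} ⊆
      {z : Sample n | z.1 = fun _ => halfReport} := fun z hz => hz.1
  refine le_trans ?_ (measure_mono hsub)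
  rw [hardLaw, jointLaw_prod_singleton]
  have := isProbabilityMeasure_hardSignals (fun _ : Fin n => (0 : I)) (fun _ => halfReport) hβ
  rw [Measure.pi_singleton]
  simp [hardSignals, signalLaw]

/-- The optimal forecast in the hard instance when all reports are `1 / 2`. -/
noncomputable def hardForecast (n : ℕ) (β : ℝ) : ℝ := 1 / (1 + (1 - β) ^ (n - 1))

theorem aggregator_hardDistribution (a b : ∀ i, S i) {β : ℝ} (hβ : β ∈ Set.Ioo (0 : ℝ) 1) :
    (aggregator (optParam (hardDistribution a b hβ)) (fun _ : Fin n => halfReport) : ℝ) =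
      hardForecast n β := by
  simp only [aggregator, hardForecast]
  rw [exp_optParam (hardDistribution_mem a b hβ), prior_hardDistribution,
    ENNReal.toReal_ofReal (hardPrior_mem hβ).1.le, hardPrior_div hβ]
  have h : ((halfReport : I) : ℝ) = 1 / 2 := rfl
  have h0 : 0 < 1 - β := by linarith [hβ.2]
  simp only [h, Finset.prod_const, Finset.card_univ, Fintype.card_fin]
  norm_num
  field_simp

/-- The joint report `(1/2, …, 1/2)` is an atom of mass at least `hardPrior β`, so the squared
distance to the optimum is already visible there. -/
theorem IsEpsOptimal.hard_sq_le (hn : 1 ≤ n) {β : ℝ} (hβ : β ∈ Set.Ioo (0 : ℝ) 1)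
    (hA : ∀ i, MeasurableSet (A i)) (ha : ∀ i, a i ∈ A i) (hb : ∀ i, b i ∉ A i) {ε : ℝ}
    {f : Reports n → I} (hf : Measurable f) (h : IsEpsOptimal (hardDistribution a b hβ) ε f) :
    hardPrior β * ((f fun _ => halfReport : ℝ) - hardForecast n β) ^ 2 ≤ ε := by
  rw [isEpsOptimal_iff hn (hardDistribution_mem a b hβ)] at h
  have hE : MeasurableSet {z : Sample n | z.1 = fun _ => halfReport} :=
    measurable_fst (measurableSet_singleton (fun _ => halfReport))
  set P := hardDistribution a b hβ with hPdef
  have hint := integrable_sq_sub (μ := reportLaw P) hf (measurable_aggregator (optParam P))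
  have h1 := setIntegral_le_integral (s := {z : Sample n | z.1 = fun _ => halfReport}) hint
    (.of_forall fun z => sq_nonneg _)
  have h2 : ∫ z in {z : Sample n | z.1 = fun _ => halfReport},
      ((f z.1 : ℝ) - aggregator (optParam P) z.1) ^ 2 ∂(reportLaw P) =
      (reportLaw P).real {z | z.1 = fun _ => halfReport} *
        ((f fun _ => halfReport : ℝ) - hardForecast n β) ^ 2 := by
    rw [← aggregator_hardDistribution a b hβ, ← smul_eq_mul, ← setIntegral_const]
    refine setIntegral_congr_fun hE fun z hz => ?_
    have hz' : z.1 = fun _ => halfReport := hz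
    simp only [hz', hPdef]
  have h3 := hardPrior_le_hardLaw_real (n := n) hβ
  rw [← reportLaw_hardDistribution hβ hA ha hb] at h3
  have h4 := mul_le_mul_of_nonneg_right h3
    (sq_nonneg ((f fun _ => halfReport : ℝ) - hardForecast n β))
  linarith

end HardLaw

/-! ### Two-point argument for the lower bound -/

section LowerBound

theorem sq_div_add_sq_div_eq {a a' : ℝ} (ha : a ∈ Set.Ioo (0 : ℝ) 1) :
    a' ^ 2 / a + (1 - a') ^ 2 / (1 - a) = 1 + (a' - a) ^ 2 / (a * (1 - a)) := by
  have h0 : a ≠ 0 := ha.1.ne'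
  have h1 : 1 - a ≠ 0 := (sub_pos.2 ha.2).ne'
  field_simp
  ring

theorem sq_div_add_sq_div_pos {a a' : ℝ} (ha : a ∈ Set.Ioo (0 : ℝ) 1) :
    0 < a' ^ 2 / a + (1 - a') ^ 2 / (1 - a) := by
  rw [sq_div_add_sq_div_eq ha]
  have h0 := ha.1
  have h1 := sub_pos.2 ha.2
  positivity

/-- Given `ω = 1` the two laws coincide, which gives the factor `1`. Given `ω = 0` they are `n`-fold
products of two-point mixtures, and the outer mixture is over the prior, which also depends on `β`.
-/
theorem chiSqBound_hardLaw (n : ℕ) {β β' : ℝ} (hβ : β ∈ Set.Ioo (0 : ℝ) 1)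
    (hβ' : β' ∈ Set.Ioo (0 : ℝ) 1) :
    ChiSqBound (ENNReal.ofReal (hardPrior β' ^ 2 / hardPrior β * 1 +
      (1 - hardPrior β') ^ 2 / (1 - hardPrior β) *
        (β' ^ 2 / β + (1 - β') ^ 2 / (1 - β)) ^ n)) (hardLaw n β') (hardLaw n β) := by
  have hk := sq_div_add_sq_div_pos (a' := β') hβ
  have hd : ∀ {α : Type} [MeasurableSpace α] (x : α),
      ChiSqBound (ENNReal.ofReal 1) (Measure.dirac x) (Measure.dirac x) := fun x => by
    rw [ENNReal.ofReal_one]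
    exact chiSqBound_self _
  have hdp : ∀ x : I, ChiSqBound (ENNReal.ofReal 1) (Measure.pi fun _ : Fin n => Measure.dirac x)
      (Measure.pi fun _ : Fin n => Measure.dirac x) := fun x => by
    rw [ENNReal.ofReal_one]
    exact chiSqBound_self _
  have h1 := (hdp halfReport).prod (hd true)
  have h2 := (((hd (0 : I)).mix hβ hβ' one_pos one_pos (hd halfReport)).pi n).prod (hd false)
  rw [← ENNReal.ofReal_mul zero_le_one, mul_one] at h1
  rw [mul_one, mul_one, ← ENNReal.ofReal_pow hk.le, ← ENNReal.ofReal_mul (by positivity),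
    mul_one] at h2
  exact h1.mix (hardPrior_mem hβ) (hardPrior_mem hβ') one_pos (by positivity) h2

variable {n : ℕ} {κ : ℝ}

/-- The parameter of the first of the two hard instances to be distinguished. -/
noncomputable def baseParam (n : ℕ) : ℝ := 1 / (2 * n)

theorem baseParam_mem (hn : 2 ≤ n) : 0 < baseParam n ∧ baseParam n ≤ 1 / 4 := by
  have h : (2 : ℝ) ≤ n := by exact_mod_cast hn
  refine ⟨by rw [baseParam]; positivity, ?_⟩
  rw [baseParam]
  exact one_div_le_one_div_of_le (by norm_num) (by linarith)

theorem baseParam_mem_Ioo (hn : 2 ≤ n) : baseParam n ∈ Set.Ioo (0 : ℝ) 1 :=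
  ⟨(baseParam_mem hn).1, by linarith [(baseParam_mem hn).2]⟩

theorem shiftedParam_mem_Ioo (hn : 2 ≤ n) (hκ : 0 ≤ κ) (hκ' : κ ≤ 1 / 2) :
    (1 + κ) * baseParam n ∈ Set.Ioo (0 : ℝ) 1 := by
  obtain ⟨h0, h1⟩ := baseParam_mem hn
  exact ⟨by positivity, by nlinarith⟩

theorem one_third_le_hardPrior {β : ℝ} (h1 : β ≤ 1 / 2) : 1 / 3 ≤ hardPrior β := by
  rw [hardPrior, div_le_div_iff₀ (by norm_num) (by linarith)]
  linarith

/-- One signal contributes `χ² = κ² * β / (1 - β) ≤ 2 * κ² * β = κ² / n`. The choice `β = 1 / (2n)`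
makes the total over `n` signals independent of `n`. -/
theorem signal_chiSq_pow_le (hn : 2 ≤ n) :
    (((1 + κ) * baseParam n) ^ 2 / baseParam n +
      (1 - (1 + κ) * baseParam n) ^ 2 / (1 - baseParam n)) ^ n ≤ Real.exp (κ ^ 2) := by
  obtain ⟨h0, h1⟩ := baseParam_mem hn
  have hn0 : (n : ℝ) ≠ 0 := by positivity
  have hβ := baseParam_mem_Ioo hn
  have hpos := sq_div_add_sq_div_pos (a' := (1 + κ) * baseParam n) hβ
  have hle : ((1 + κ) * baseParam n) ^ 2 / baseParam n +
      (1 - (1 + κ) * baseParam n) ^ 2 / (1 - baseParam n) ≤ Real.exp (κ ^ 2 / n) := by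
    rw [sq_div_add_sq_div_eq hβ]
    have hq : 0 < 1 - baseParam n := by linarith
    have h2 : ((1 + κ) * baseParam n - baseParam n) ^ 2 / (baseParam n * (1 - baseParam n)) ≤
        κ ^ 2 / n := by
      have e : κ ^ 2 / n = κ ^ 2 * (2 * baseParam n) := by
        rw [baseParam]
        field_simp
      rw [e, div_le_iff₀ (by positivity)]
      have : 0 ≤ κ ^ 2 * baseParam n ^ 2 * (1 - 2 * baseParam n) :=
        mul_nonneg (by positivity) (by linarith)
      nlinarith
    linarith [Real.add_one_le_exp (κ ^ 2 / (n : ℝ))]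
  calc _ ≤ Real.exp (κ ^ 2 / n) ^ n := pow_le_pow_left₀ hpos.le hle n
    _ = Real.exp (κ ^ 2) := by
      rw [← Real.exp_nat_mul]
      congr 1
      field_simp

theorem prior_chiSq_le {β : ℝ} (h0 : 0 < β) (h1 : β ≤ 1 / 4) (hκ : 0 ≤ κ) (hκ' : κ ≤ 1 / 2) :
    hardPrior ((1 + κ) * β) ^ 2 / hardPrior β +
      (1 - hardPrior ((1 + κ) * β)) ^ 2 / (1 - hardPrior β) ≤ Real.exp (κ ^ 2) := by
  have hβ : β ∈ Set.Ioo (0 : ℝ) 1 := ⟨h0, by linarith⟩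
  rw [sq_div_add_sq_div_eq (hardPrior_mem hβ)]
  have hβ' : (1 + κ) * β ≤ 1 / 2 := by nlinarith
  have d1 : 0 < 2 - β := by linarith
  have d2 : 1 ≤ 2 - (1 + κ) * β := by linarith
  have d3 : 0 < 1 - β := by linarith
  have e : (hardPrior ((1 + κ) * β) - hardPrior β) ^ 2 / (hardPrior β * (1 - hardPrior β)) =
      (κ * β) ^ 2 / ((2 - (1 + κ) * β) ^ 2 * (1 - β)) := by
    have d4 : 2 - (1 + κ) * β ≠ 0 := by linarith
    rw [one_sub_hardPrior hβ.2, hardPrior, hardPrior]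
    field_simp
    ring
  have h2 : (κ * β) ^ 2 / ((2 - (1 + κ) * β) ^ 2 * (1 - β)) ≤ κ ^ 2 := by
    rw [div_le_iff₀ (by positivity), mul_pow]
    refine mul_le_mul_of_nonneg_left ?_ (sq_nonneg κ)
    have : 1 ≤ (2 - (1 + κ) * β) ^ 2 := one_le_pow₀ d2
    nlinarith
  rw [e]
  linarith [Real.add_one_le_exp (κ ^ 2)]

theorem chiSqBound_hardLaw_exp (hn : 2 ≤ n) (hκ : 0 ≤ κ) (hκ' : κ ≤ 1 / 2) :
    ChiSqBound (ENNReal.ofReal (Real.exp (2 * κ ^ 2))) (hardLaw n ((1 + κ) * baseParam n))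
      (hardLaw n (baseParam n)) := by
  obtain ⟨h0, h1⟩ := baseParam_mem hn
  have hβ := baseParam_mem_Ioo hn
  intro f hf
  refine (chiSqBound_hardLaw n hβ (shiftedParam_mem_Ioo hn hκ hκ') f hf).trans ?_
  gcongr
  have hp := hardPrior_mem hβ
  have hq := sub_pos.2 hp.2
  have hp0 := hp.1
  have hk := signal_chiSq_pow_le (κ := κ) hn
  have hone : 1 ≤ Real.exp (κ ^ 2) := Real.one_le_exp (sq_nonneg κ)
  calc _ ≤ hardPrior ((1 + κ) * baseParam n) ^ 2 / hardPrior (baseParam n) * Real.exp (κ ^ 2) +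
        (1 - hardPrior ((1 + κ) * baseParam n)) ^ 2 / (1 - hardPrior (baseParam n)) *
          Real.exp (κ ^ 2) :=
        add_le_add (mul_le_mul_of_nonneg_left hone (by positivity))
          (mul_le_mul_of_nonneg_left hk (by positivity))
    _ ≤ Real.exp (κ ^ 2) * Real.exp (κ ^ 2) := by
      rw [← add_mul]
      exact mul_le_mul_of_nonneg_right (prior_chiSq_le h0 h1 hκ hκ') (Real.exp_nonneg _)
    _ = Real.exp (2 * κ ^ 2) := by rw [← Real.exp_add, two_mul]

/-- Write `x` and `y` for `(1 - β) ^ (n - 1)` at the base and the shifted parameter. Bernoulli's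
inequality gives `y ≥ 1 / 4` and, since `(n - 1) * β ≥ 1 / 4`, also `x / y ≥ 1 + κ / 4`. So `x - y ≥
κ / 16`, and the forecasts differ by `(x - y) / ((1 + x) * (1 + y))` with denominator at most `4`.
-/
theorem hardForecast_sub_ge (hn : 2 ≤ n) (hκ : 0 ≤ κ) (hκ' : κ ≤ 1 / 2) :
    κ / 64 ≤ hardForecast n ((1 + κ) * baseParam n) - hardForecast n (baseParam n) := by
  obtain ⟨h0, h1⟩ := baseParam_mem hn
  obtain ⟨h2, h3⟩ := shiftedParam_mem_Ioo hn hκ hκ'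
  have hn' : (2 : ℝ) ≤ n := by exact_mod_cast hn
  have hcast : ((n - 1 : ℕ) : ℝ) = n - 1 := by
    rw [Nat.cast_sub (by omega), Nat.cast_one]
  have hmul : (n : ℝ) * baseParam n = 1 / 2 := by
    rw [baseParam]
    field_simp
  set β := baseParam n
  have hβ' : (1 + κ) * β ≤ 1 / 2 := by nlinarith
  have hy : 1 / 4 ≤ (1 - (1 + κ) * β) ^ (n - 1) := by
    have h := one_add_mul_le_pow (a := -((1 + κ) * β)) (by linarith) (n - 1)
    rw [hcast, ← sub_eq_add_neg] at h
    nlinarith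
  have hxy : (1 - (1 + κ) * β) ^ (n - 1) * (1 + κ / 4) ≤ (1 - β) ^ (n - 1) := by
    have hq : 0 < 1 - (1 + κ) * β := by linarith
    have h := one_add_mul_le_pow (a := κ * β / (1 - (1 + κ) * β))
      (by have : 0 ≤ κ * β / (1 - (1 + κ) * β) := by positivity
          linarith) (n - 1)
    have e : 1 + κ * β / (1 - (1 + κ) * β) = (1 - β) / (1 - (1 + κ) * β) := by
      rw [eq_div_iff hq.ne', add_mul, div_mul_cancel₀ _ hq.ne']
      ring
    rw [e, div_pow, le_div_iff₀ (by positivity), hcast] at h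
    refine le_trans ?_ h
    rw [mul_comm]
    refine mul_le_mul_of_nonneg_right ?_ (by positivity)
    have h4 : κ * β ≤ κ * β / (1 - (1 + κ) * β) := by
      rw [le_div_iff₀ hq]
      nlinarith [mul_nonneg hκ h0.le]
    have h5 : κ / 4 ≤ (n - 1) * (κ * β) := by nlinarith
    have h6 := mul_le_mul_of_nonneg_left h4 (by linarith : (0 : ℝ) ≤ n - 1)
    linarith
  have hx1 : (1 - β) ^ (n - 1) ≤ 1 := pow_le_one₀ (by linarith) (by linarith)
  rw [hardForecast, hardForecast]
  set x := (1 - β) ^ (n - 1)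
  set y := (1 - (1 + κ) * β) ^ (n - 1)
  have hyx : y ≤ x := by nlinarith
  have hy0 : 0 < 1 + y := by linarith
  have hx0 : 0 < 1 + x := by linarith
  rw [div_sub_div _ _ hy0.ne' hx0.ne', le_div_iff₀ (by positivity)]
  have hprod : (1 + y) * (1 + x) ≤ 4 := by nlinarith
  have hd : κ / 16 ≤ x - y := by nlinarith
  nlinarith

variable {S : Fin n → Type*} [∀ i, MeasurableSpace (S i)] {T : ℕ}

/-- The training outcomes for which the forecast at the reports `(1/2, …, 1/2)` is close to the
optimal one of the hard instance with parameter `β`. -/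
def closeSet (A : Learner n T) (ε β : ℝ) : Set (A.Seed × (Fin T → Sample n)) :=
  {x | hardPrior β * ((A.output x.1 x.2 fun _ => halfReport : ℝ) - hardForecast n β) ^ 2 ≤ ε}

theorem measurableSet_closeSet (A : Learner n T) (ε β : ℝ) : MeasurableSet (closeSet A ε β) := by
  have h : Measurable fun x : A.Seed × (Fin T → Sample n) =>
      A.output x.1 x.2 fun _ => halfReport :=
    A.measurable_output.comp (measurable_fst.prodMk (measurable_snd.prodMk measurable_const))
  exact measurableSet_le (((measurable_subtype_coe.comp h).sub_const _).pow_const 2 |>.const_mul _)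
    measurable_const

theorem measurable_output_section (A : Learner n T) (x : A.Seed × (Fin T → Sample n)) :
    Measurable (A.output x.1 x.2) :=
  A.measurable_output.comp (measurable_const.prodMk (measurable_const.prodMk measurable_id))

/-- Both priors are at least `1 / 3`, so a common point would put the two forecasts at squared
distance at most `12 * ε`. The factor `2 ^ 16` makes `(κ / 64) ^ 2 = 16 * ε`, which is larger. -/
theorem disjoint_closeSet (hn : 2 ≤ n) (A : Learner n T) {ε : ℝ} (hε : 0 < ε) (hκ : 0 ≤ κ)
    (hκ' : κ ≤ 1 / 2) (hκε : κ ^ 2 = 2 ^ 16 * ε) :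
    Disjoint (closeSet A ε ((1 + κ) * baseParam n)) (closeSet A ε (baseParam n)) := by
  obtain ⟨h0, h1⟩ := baseParam_mem hn
  rw [Set.disjoint_left]
  intro x hx' hx
  have hd := hardForecast_sub_ge hn hκ hκ'
  have hp := one_third_le_hardPrior (β := baseParam n) (by linarith)
  have hp' := one_third_le_hardPrior (β := (1 + κ) * baseParam n) (by nlinarith)
  have hx2 : hardPrior (baseParam n) *
      ((A.output x.1 x.2 fun _ => halfReport : ℝ) - hardForecast n (baseParam n)) ^ 2 ≤ ε := hx
  have hx2' : hardPrior ((1 + κ) * baseParam n) * ((A.output x.1 x.2 fun _ => halfReport : ℝ) -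
      hardForecast n ((1 + κ) * baseParam n)) ^ 2 ≤ ε := hx'
  set f : ℝ := ((A.output x.1 x.2 fun _ => halfReport : I) : ℝ)
  set u := hardForecast n (baseParam n)
  set v := hardForecast n ((1 + κ) * baseParam n)
  have h3 : (f - u) ^ 2 ≤ 3 * ε := by
    linarith [mul_le_mul_of_nonneg_right hp (sq_nonneg (f - u))]
  have h4 : (f - v) ^ 2 ≤ 3 * ε := by
    linarith [mul_le_mul_of_nonneg_right hp' (sq_nonneg (f - v))]
  have h5 : (κ / 64) ^ 2 ≤ (v - u) ^ 2 := pow_le_pow_left₀ (by positivity) hd 2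
  have h6 : (v - u) ^ 2 ≤ 2 * (f - u) ^ 2 + 2 * (f - v) ^ 2 := by
    linarith [sq_nonneg ((f - u) + (f - v)), show (v - u) ^ 2 + ((f - u) + (f - v)) ^ 2 =
      2 * (f - u) ^ 2 + 2 * (f - v) ^ 2 by ring]
  rw [div_pow, hκε] at h5
  linarith

/-- The law of the training outcome in the hard instance with parameter `β`. -/
noncomputable def hardTraining (A : Learner n T) (β : ℝ) :
    Measure (A.Seed × (Fin T → Sample n)) :=
  (A.seedLaw : Measure A.Seed).prod (Measure.pi fun _ : Fin T => hardLaw n β)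

theorem le_hardTraining_closeSet (hn : 1 ≤ n) {B : ∀ i, Set (S i)} {a b : ∀ i, S i}
    (hB : ∀ i, MeasurableSet (B i)) (ha : ∀ i, a i ∈ B i) (hb : ∀ i, b i ∉ B i) {ε δ : ℝ}
    {A : Learner n T}
    (hA : ∀ P ∈ condIndepFamily S,
      ENNReal.ofReal (1 - δ) ≤ trainingLaw A P {x | IsEpsOptimal P ε (A.output x.1 x.2)})
    {β : ℝ} (hβ : β ∈ Set.Ioo (0 : ℝ) 1) :
    ENNReal.ofReal (1 - δ) ≤ hardTraining A β (closeSet A ε β) := by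
  refine (hA _ (hardDistribution_mem a b hβ)).trans ?_
  rw [trainingLaw, reportLaw_hardDistribution hβ hB ha hb]
  exact measure_mono fun x hx =>
    IsEpsOptimal.hard_sq_le hn hβ hB ha hb (measurable_output_section A x) hx

/-- The set of outcomes close to the shifted optimum has probability at least `1 - δ` under the
shifted law and, by disjointness, at most `δ` under the base law. The chi-square bound for the seed
and the `T` samples relates the two. -/
theorem sq_one_sub_le_of_samplesSuffice (hn : 2 ≤ n) {B : ∀ i, Set (S i)} {a b : ∀ i, S i}
    (hB : ∀ i, MeasurableSet (B i)) (ha : ∀ i, a i ∈ B i) (hb : ∀ i, b i ∉ B i) {ε δ : ℝ}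
    (hε : 0 < ε) (hδ : 0 < δ) (hδ' : δ < 1) (hκ : 0 ≤ κ) (hκ' : κ ≤ 1 / 2)
    (hκε : κ ^ 2 = 2 ^ 16 * ε) (h : SamplesSuffice (condIndepFamily S) ε δ T) :
    (1 - δ) ^ 2 ≤ Real.exp (2 ^ 17 * ε * T) * δ := by
  obtain ⟨A, hA⟩ := h
  have hβ := baseParam_mem_Ioo hn
  have hβ' := shiftedParam_mem_Ioo hn hκ hκ'
  have hg := le_hardTraining_closeSet (by omega) hB ha hb hA hβ
  have hg' := le_hardTraining_closeSet (by omega) hB ha hb hA hβ'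
  have := isProbabilityMeasure_hardLaw n hβ
  have := isProbabilityMeasure_hardLaw n hβ'
  have hchi := ((chiSqBound_self (A.seedLaw : Measure A.Seed)).prod
    ((chiSqBound_hardLaw_exp hn hκ hκ').pi T)).apply_sq_le
      (measurableSet_closeSet A ε ((1 + κ) * baseParam n))
  have hprob : IsProbabilityMeasure (hardTraining A (baseParam n)) := by
    rw [hardTraining]
    infer_instance
  have hsmall : hardTraining A (baseParam n) (closeSet A ε ((1 + κ) * baseParam n)) ≤
      ENNReal.ofReal δ := by
    refine (measure_mono (disjoint_closeSet hn A hε hκ hκ' hκε).subset_compl_right).trans ?_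
    rw [prob_compl_eq_one_sub (measurableSet_closeSet A ε _)]
    refine (tsub_le_tsub_left hg 1).trans ?_
    rw [← ENNReal.ofReal_one, ← ENNReal.ofReal_sub _ (by linarith)]
    exact ENNReal.ofReal_le_ofReal (by linarith)
  have hfin : ENNReal.ofReal ((1 - δ) ^ 2) ≤
      ENNReal.ofReal (Real.exp (2 ^ 17 * ε * T) * δ) := by
    have e : 2 ^ 17 * ε * T = T * (2 * κ ^ 2) := by
      rw [hκε]
      ring
    rw [ENNReal.ofReal_pow (by linarith), ENNReal.ofReal_mul (Real.exp_nonneg _), e,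
      Real.exp_nat_mul, ENNReal.ofReal_pow (Real.exp_nonneg _)]
    rw [one_mul] at hchi
    exact (pow_le_pow_left' hg' 2).trans (hchi.trans (mul_le_mul_right hsmall _))
  exact (ENNReal.ofReal_le_ofReal_iff (by positivity)).1 hfin

theorem log_le_of_sq_one_sub_le {δ t : ℝ} (hδ : 0 < δ) (hδ' : δ ≤ 1 / 4)
    (h : (1 - δ) ^ 2 ≤ Real.exp t * δ) : Real.log (1 / δ) ≤ 2 * t := by
  -- This is where `δ ≤ 1 / 4` enters; squaring the hypothesis then leaves `δ ≤ exp (2 * t) * δ ^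
  -- 2`.
  have h1 : δ ≤ (1 - δ) ^ 4 := by
    have h2 : (3 / 4 : ℝ) ^ 4 ≤ (1 - δ) ^ 4 := pow_le_pow_left₀ (by norm_num) (by linarith) 4
    linarith [show (1 / 4 : ℝ) ≤ (3 / 4) ^ 4 by norm_num]
  have h2 : (1 - δ) ^ 4 ≤ (Real.exp t * δ) ^ 2 := by
    calc (1 - δ) ^ 4 = ((1 - δ) ^ 2) ^ 2 := by ring
      _ ≤ _ := pow_le_pow_left₀ (sq_nonneg _) h 2
  have h3 : δ * 1 ≤ δ * (δ * Real.exp (2 * t)) := by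
    have e : Real.exp (2 * t) = Real.exp t ^ 2 := by
      rw [← Real.exp_nat_mul]
      norm_num
    rw [e]
    linarith [show δ * (δ * Real.exp t ^ 2) = (Real.exp t * δ) ^ 2 by ring]
  have h4 := le_of_mul_le_mul_left h3 hδ
  rw [Real.log_le_iff_le_exp (by positivity), div_le_iff₀ hδ]
  linarith

theorem le_sampleComplexity (hn : 2 ≤ n)
    (hS : ∀ i, ∃ B : Set (S i), MeasurableSet B ∧ B.Nonempty ∧ Bᶜ.Nonempty) {ε δ : ℝ}
    (hε : 0 < ε) (hε' : ε ≤ 1 / 2 ^ 18) (hδ : 0 < δ) (hδ' : δ ≤ 1 / 4) :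
    ENNReal.ofReal (1 / 2 ^ 18 * (1 / ε * Real.log (1 / δ))) ≤
      (sampleComplexity (condIndepFamily S) ε δ : ℝ≥0∞) := by
  choose B hB hne hne' using hS
  choose a ha using hne
  choose b hb using hne'
  set κ := Real.sqrt (2 ^ 16 * ε) with hκ
  have hκε : κ ^ 2 = 2 ^ 16 * ε := Real.sq_sqrt (by positivity)
  -- The threshold `1 / 2 ^ 18` for `ε` is what makes `κ ^ 2 = 2 ^ 16 * ε ≤ 1 / 4`.
  have hκ' : κ ≤ 1 / 2 := by
    rw [hκ, Real.sqrt_le_left (by norm_num)]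
    linarith
  set x := 1 / 2 ^ 18 * (1 / ε * Real.log (1 / δ)) with hx
  have hle : ∀ T, SamplesSuffice (condIndepFamily S) ε δ T → x ≤ T := fun T hT => by
    have h := log_le_of_sq_one_sub_le hδ hδ' (sq_one_sub_le_of_samplesSuffice hn hB ha hb hε hδ
      (by linarith) (Real.sqrt_nonneg _) hκ' hκε hT)
    rw [hx, one_div_mul_eq_div ε, mul_div_assoc', div_le_iff₀ hε]
    linarith
  calc ENNReal.ofReal x ≤ ENNReal.ofReal (⌈x⌉₊ : ℝ) := ENNReal.ofReal_le_ofReal (Nat.le_ceil x)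
    _ = ((⌈x⌉₊ : ℕ∞) : ℝ≥0∞) := by simp
    _ ≤ _ := by
      refine ENat.toENNReal_le.2 (le_iInf₂ fun N hN => ?_)
      -- Any admissible `N` is itself a number of samples that suffices.
      exact_mod_cast Nat.ceil_le.2 (hle N (hN N le_rfl))

end LowerBound

end ForecastAggregation

theorem theorem5p2 :
    ∃ C c ε₀ δ₀ : ℝ, 0 < C ∧ 0 < c ∧ ε₀ ∈ Set.Ioo (0 : ℝ) 1 ∧ δ₀ ∈ Set.Ioo (0 : ℝ) 1 ∧
      ∀ (n : ℕ), 2 ≤ n → ∀ (S : Fin n → Type*) [∀ i, MeasurableSpace (S i)],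
        (∀ ε δ : ℝ, 0 < ε → ε < 1 → 0 < δ → δ < 1 →
          (ForecastAggregation.sampleComplexity
              (ForecastAggregation.condIndepFamily S) ε δ : ℝ≥0∞) ≤
            ENNReal.ofReal (C * (1 / ε ^ 2 * Real.log (1 / (ε * δ))))) ∧
        ((∀ i, ∃ A : Set (S i), MeasurableSet A ∧ A.Nonempty ∧ Aᶜ.Nonempty) →
          ∀ ε δ : ℝ, 0 < ε → ε ≤ ε₀ → 0 < δ → δ ≤ δ₀ →
            ENNReal.ofReal (c * (1 / ε * Real.log (1 / δ))) ≤
              (ForecastAggregation.sampleComplexity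
                (ForecastAggregation.condIndepFamily S) ε δ : ℝ≥0∞)) := by
  refine ⟨33, 1 / 2 ^ 18, 1 / 2 ^ 18, 1 / 4, by norm_num, by norm_num, by norm_num, by norm_num,
    fun n hn S _ => ⟨fun ε δ hε _ hδ hδ' => ?_, fun hS ε δ hε hε' hδ hδ' => ?_⟩⟩
  · exact ForecastAggregation.sampleComplexity_le (by omega) hε hδ hδ'
  · exact ForecastAggregation.le_sampleComplexity hn hS hε hε' hδ hδ'
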